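/- Let $d\ge 2$, write $B_1=\{x\in\mathbb R^d:|x|\le 1\}$, $a^-=\max(-a,0)$, and let $\beta,b:\mathbb R\to\mathbb R$, $D,K:\mathbb R^d\to\mathbb R^d$ satisfy: (i) $\beta\in C^1(\mathbb R)$, $\beta(0)=0$, and $\beta'(r)\ge\alpha$ for all $r\in\mathbb R$, for some $\alpha>0$; (ii) $D\in L^\infty(\mathbb R^d;\mathbb R^d)\cap L^2(\mathbb R^d;\mathbb R^d)$ and $(\operatorname{div}D)^-=0$, that is, $\operatorname{div}D\ge0$ in the sense of distributions; (iii) $b\in C^1(\mathbb R)$ and $b\ge0$; (iv) $K\in C^1(\mathbb R^d\setminus\{0\};\mathbb R^d)\cap L^1(B_1;\mathbb R^d)\cap L^p(B_1^c;\mathbb R^d)$ for some $1\le p\le2$, $(\operatorname{div}K)^-\in L^\infty(\mathbb R^d)$ (with $\operatorname{div}K$ the pointwise divergence off the origin), and $(K(x)\cdot x)^-|x|^{-1}\in L^\infty(B_1)$; (v) $K\in L^\infty(B_1^c;\mathbb R^d)$. Let $u_0\in L^\infty(\mathbb R^d)$ be a probability density (i.e. $u_0\in L^1$, $u_0\ge0$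 a.e., $\int u_0\,dx=1$), and let $u:[0,\infty)\to L^2(\mathbb R^d)$ be the weak solution of $$\partial_tu-\Delta\beta(u)+\operatorname{div}\big((D\,b(u)+K*u)\,u\big)=0,\qquad u(0)=u_0,$$ for which $u(t)$ is a probability density for every $t\ge0$ and $u\in L^2(0,T;H^1)\cap L^\infty((0,T)\times\mathbb R^d)$ for every $T>0$. Here weak solution means that $u\in C([0,\infty);H^{-1})$, that $\frac{du}{dt}\in L^2(0,T;H^{-1})$, $\beta(u)\in L^2(0,T;H^1)$ and $(D\,b(u)+K*u)\,u\in L^2(0,T;L^2)$ for every $T>0$, that $u(0)=u_0$, and that for a.e. $t>0$ and all $\varphi\in H^1(\mathbb R^d)$ $$\Big\langle\frac{du}{dt}(t),\varphi\Big\rangle+\int_{\mathbb R^d}\big(\nabla\beta(u)-(D\,b(u)+K*u)\,u\big)\cdot\nabla\varphi\,dx=0.$$ Fix $T>0$ and put $Q_T=(0,T)\times\mathbb R^d$. Let $v_1,v_2\in L^1(Q_T)\cap L^\infty(Q_T)$ be two distributional solutions on $Q_T$ of the linear ("frozen") equation $$\partial_tv-\Delta\Big(\frac{\beta(u)}u\,v\Big)+\operatorname{div}\big((D\,b(u)+K*u)\,v\big)=0,$$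 where $\beta(r)/r$ is understood as $\beta'(0)$ at $r=0$; that is, $v$, $\frac{\beta(u)}u v$ and $(D\,b(u)+K*u)v$ are locally integrable on $Q_T$ and $$\int_{Q_T}v\Big(\partial_t\varphi+\frac{\beta(u)}u\,\Delta\varphi+(D\,b(u)+K*u)\cdot\nabla\varphi\Big)\,dt\,dx=0\qquad\text{for all }\varphi\in C_0^\infty(Q_T).$$ Suppose that $v_1$ and $v_2$ have the same weak initial datum, in the sense that $$\lim_{t\downarrow0}\ \operatorname*{ess\,sup}_{0<s<t}\Big|\int_{\mathbb R^d}(v_1(s,x)-v_2(s,x))\,\psi(x)\,dx\Big|=0\qquad\text{for all }\psi\in C_0^\infty(\mathbb R^d).$$ Then $v_1=v_2$ almost everywhere in $Q_T$. -/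

import Mathlib

open MeasureTheory Set Filter Topology
open scoped ContDiff ENNReal Laplacian

noncomputable section

namespace FrozenFP

/-- The Euclidean space of dimension `d`. -/
abbrev Sp (d : ℕ) : Type := EuclideanSpace ℝ (Fin d)

/-- Smooth real functions with compact support contained in the (open) set `O`. -/
def IsTest {X : Type*} [NormedAddCommGroup X] [NormedSpace ℝ X] (O : Set X) (φ : X → ℝ) : Prop :=
  ContDiff ℝ ∞ φ ∧ HasCompactSupport φ ∧ tsupport φ ⊆ O

/-- The space-time cylinder `(0,T) × ℝᵈ`. -/
def cyl (d : ℕ) (T : ℝ) : Set (ℝ × Sp d) := Ioo 0 T ×ˢ univ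

/-- Lebesgue measure on the space-time cylinder `(0,T) × ℝᵈ`. -/
abbrev cylMeasure (d : ℕ) (T : ℝ) : Measure (ℝ × Sp d) := volume.restrict (cyl d T)

/-- The real Hilbert space `L²(ℝᵈ)`. -/
abbrev L2 (d : ℕ) : Type := Lp ℝ 2 (volume : Measure (Sp d))

/-- The real Hilbert space `L²(ℝᵈ; ℝᵈ)`. -/
abbrev L2vec (d : ℕ) : Type := Lp (Sp d) 2 (volume : Measure (Sp d))

/-! ### The Sobolev space `H¹(ℝᵈ)` and its dual -/

theorem integrable_smul_gradient {d : ℕ} (f : L2 d) {φ : Sp d → ℝ} (hφ : IsTest univ φ) :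
    Integrable (fun x => f x • gradient φ x) volume := by
  have hc : Continuous (gradient φ) :=
    (InnerProductSpace.toDual ℝ (Sp d)).symm.continuous.comp
      (hφ.1.continuous_fderiv (by simp))
  have hs : HasCompactSupport (gradient φ) :=
    (hφ.2.1.fderiv (𝕜 := ℝ)).comp_left (map_zero _)
  exact (hc.memLp_of_hasCompactSupport hs (p := 2)).smul (Lp.memLp f) |> memLp_one_iff_integrable.mp

theorem integrable_smul_vec {d : ℕ} (g : L2vec d) {φ : Sp d → ℝ} (hφ : IsTest univ φ) :
    Integrable (fun x => φ x • g x) volume :=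
  memLp_one_iff_integrable.mp
    ((Lp.memLp g).smul (hφ.1.continuous.memLp_of_hasCompactSupport hφ.2.1 (p := 2)))

/-- `g` is the weak gradient of `f`: `∫ f ∇φ = - ∫ φ g` for all test functions `φ`. -/
def IsWeakGradient {d : ℕ} (f : L2 d) (g : L2vec d) : Prop :=
  ∀ φ : Sp d → ℝ, IsTest univ φ →
    ∫ x, f x • gradient φ x = - ∫ x, φ x • g x

/-- `H¹(ℝᵈ)`, as the space of pairs `(f, ∇f)` in `L² × L²` with `∇f` the weak gradient of `f`. Its
norm is `(‖f‖² + ‖∇f‖²)^(1/2)`. -/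
def H1 (d : ℕ) : Submodule ℝ (WithLp 2 (L2 d × L2vec d)) where
  carrier := {p | IsWeakGradient p.fst p.snd}
  zero_mem' := by
    intro φ hφ
    have h1 : ∫ x, ((0 : L2 d) : Sp d → ℝ) x • gradient φ x = 0 := by
      rw [← integral_zero (Sp d) (Sp d)]
      refine integral_congr_ae ?_
      filter_upwards [Lp.coeFn_zero ℝ 2 (volume : Measure (Sp d))] with x hx
      rw [hx]; simp
    have h2 : ∫ x, φ x • ((0 : L2vec d) : Sp d → Sp d) x = 0 := by
      rw [← integral_zero (Sp d) (Sp d)]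
      refine integral_congr_ae ?_
      filter_upwards [Lp.coeFn_zero (Sp d) 2 (volume : Measure (Sp d))] with x hx
      rw [hx]; simp
    change ∫ x, ((0 : L2 d) : Sp d → ℝ) x • gradient φ x
      = - ∫ x, φ x • ((0 : L2vec d) : Sp d → Sp d) x
    rw [h1, h2, neg_zero]
  add_mem' := by
    intro p q hp hq φ hφ
    have h1 : ∫ x, ((p.fst + q.fst : L2 d) : Sp d → ℝ) x • gradient φ x
        = (∫ x, p.fst x • gradient φ x) + ∫ x, q.fst x • gradient φ x := by
      rw [← integral_add (integrable_smul_gradient _ hφ) (integrable_smul_gradient _ hφ)]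
      refine integral_congr_ae ?_
      filter_upwards [Lp.coeFn_add p.fst q.fst] with x hx
      rw [hx, Pi.add_apply, add_smul]
    have h2 : ∫ x, φ x • ((p.snd + q.snd : L2vec d) : Sp d → Sp d) x
        = (∫ x, φ x • p.snd x) + ∫ x, φ x • q.snd x := by
      rw [← integral_add (integrable_smul_vec _ hφ) (integrable_smul_vec _ hφ)]
      refine integral_congr_ae ?_
      filter_upwards [Lp.coeFn_add p.snd q.snd] with x hx
      rw [hx, Pi.add_apply, smul_add]
    change ∫ x, ((p.fst + q.fst : L2 d) : Sp d → ℝ) x • gradient φ x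
      = - ∫ x, φ x • ((p.snd + q.snd : L2vec d) : Sp d → Sp d) x
    rw [h1, h2, hp φ hφ, hq φ hφ, neg_add]
  smul_mem' := by
    intro c p hp φ hφ
    have h1 : ∫ x, ((c • p.fst : L2 d) : Sp d → ℝ) x • gradient φ x
        = c • ∫ x, p.fst x • gradient φ x := by
      rw [← integral_smul]
      refine integral_congr_ae ?_
      filter_upwards [Lp.coeFn_smul c p.fst] with x hx
      rw [hx, Pi.smul_apply, smul_assoc]
    have h2 : ∫ x, φ x • ((c • p.snd : L2vec d) : Sp d → Sp d) x
        = c • ∫ x, φ x • p.snd x := by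
      rw [← integral_smul]
      refine integral_congr_ae ?_
      filter_upwards [Lp.coeFn_smul c p.snd] with x hx
      rw [hx, Pi.smul_apply, smul_comm]
    change ∫ x, ((c • p.fst : L2 d) : Sp d → ℝ) x • gradient φ x
      = - ∫ x, φ x • ((c • p.snd : L2vec d) : Sp d → Sp d) x
    rw [h1, h2, hp φ hφ, smul_neg]

/-- The underlying `L²` function of an element of `H¹`. -/
def h1val {d : ℕ} (w : H1 d) : L2 d := (w : WithLp 2 (L2 d × L2vec d)).fst

/-- The weak gradient of an element of `H¹`. -/
def h1grad {d : ℕ} (w : H1 d) : L2vec d := (w : WithLp 2 (L2 d × L2vec d)).snd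

/-- `H⁻¹(ℝᵈ)`, the dual of `H¹(ℝᵈ)`, with the dual norm. -/
abbrev Hneg1 (d : ℕ) : Type := StrongDual ℝ (H1 d)

/-- The embedding `L² → H⁻¹`, `f ↦ (w ↦ ∫ f w)`. -/
def toHneg1 {d : ℕ} (f : L2 d) : Hneg1 d :=
  (innerSL ℝ f).comp ((WithLp.fstL 2 ℝ (L2 d) (L2vec d)).comp (H1 d).subtypeL)

/-! ### The coefficients -/

/-- The (classical) divergence of a vector field. -/
def divergence {d : ℕ} (F : Sp d → Sp d) (x : Sp d) : ℝ :=
  LinearMap.trace ℝ (Sp d) (fderiv ℝ F x : Sp d →ₗ[ℝ] Sp d)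

/-- The hypotheses on the coefficients `β`, `b`, `D`, `K`. -/
structure Hypotheses (d : ℕ) (β b : ℝ → ℝ) (D K : Sp d → Sp d) : Prop where
  β_contDiff : ContDiff ℝ 1 β
  β_zero : β 0 = 0
  β_deriv : ∃ α : ℝ, 0 < α ∧ ∀ r, α ≤ deriv β r
  D_bounded : MemLp D ∞ volume
  D_l2 : MemLp D 2 volume
  /-- `div D ≥ 0` in the sense of distributions. -/
  D_div : ∀ φ : Sp d → ℝ, IsTest univ φ → (∀ x, 0 ≤ φ x) → ∫ x, inner ℝ (D x) (gradient φ x) ≤ 0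
  b_contDiff : ContDiff ℝ 1 b
  b_nonneg : ∀ r, 0 ≤ b r
  K_contDiff : ContDiffOn ℝ 1 K {0}ᶜ
  K_near : IntegrableOn K (Metric.closedBall 0 1) volume
  K_far : ∃ p : ℝ≥0∞, 1 ≤ p ∧ p ≤ 2 ∧ MemLp K p (volume.restrict (Metric.closedBall 0 1)ᶜ)
  /-- The negative part of `div K` (defined off the origin) is bounded. -/
  K_div : MemLp (fun x => max (-divergence K x) 0) ∞ volume
  /-- The negative part of `K(x)·x`, divided by `|x|`, is bounded on the unit ball. -/
  K_radial : MemLp (fun x => max (-inner ℝ (K x) x) 0 / ‖x‖) ∞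
    (volume.restrict (Metric.closedBall 0 1))
  K_far_bounded : MemLp K ∞ (volume.restrict (Metric.closedBall 0 1)ᶜ)

/-- The drift field `D b(w) + K * w` generated by a function `w` on `ℝᵈ`, where
`(K * w)(x) = ∫ w(y) K(x - y) dy`. -/
def drift {d : ℕ} (b : ℝ → ℝ) (D K : Sp d → Sp d) (w : Sp d → ℝ) (x : Sp d) : Sp d :=
  b (w x) • D x + convolution w K (ContinuousLinearMap.lsmul ℝ ℝ) volume x

/-- The quotient `β(r)/r`, extended to `r = 0` by its limit `β'(0)`. -/
def diffusivity (β : ℝ → ℝ) (r : ℝ) : ℝ := if r = 0 then deriv β 0 else β r / r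

/-! ### The nonlinear equation -/

/-- Probability densities on `ℝᵈ`. -/
def IsProbDensity {d : ℕ} (w : Sp d → ℝ) : Prop :=
  Integrable w volume ∧ 0 ≤ᵐ[volume] w ∧ ∫ x, w x = 1

/-- `u : [0,∞) → L²` is a weak solution of `∂ₜu - Δβ(u) + div((D b(u) + K*u) u) = 0`, `u(0) = u₀`.
The witnesses are: `U`, the curve `t ↦ u(t)` in `L²`; `U'`, its derivative in `H⁻¹`; `G`, the curve
`t ↦ β(u(t))` in `H¹`; `F`, the curve `t ↦ (D b(u(t)) + K*u(t)) u(t)` in `L²`. -/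
def IsWeakSolution {d : ℕ} (β b : ℝ → ℝ) (D K : Sp d → Sp d) (u₀ : Sp d → ℝ)
    (u : ℝ → Sp d → ℝ) : Prop :=
  ∃ (U : ℝ → L2 d) (U' : ℝ → Hneg1 d) (G : ℝ → H1 d) (F : ℝ → L2vec d),
    (∀ t, 0 ≤ t → U t =ᵐ[volume] u t) ∧
    -- `u ∈ C([0,∞); H⁻¹)`
    ContinuousOn (fun t => toHneg1 (U t)) (Ici 0) ∧
    -- `du/dt ∈ L²(0,T; H⁻¹)`, in the sense of `H⁻¹`-valued distributions
    (∀ T : ℝ, 0 < T → MemLp U' 2 (volume.restrict (Ioo 0 T))) ∧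
    (∀ θ : ℝ → ℝ, IsTest (Ioi 0) θ →
      ∫ t in Ioi (0 : ℝ), deriv θ t • toHneg1 (U t) = - ∫ t in Ioi (0 : ℝ), θ t • U' t) ∧
    -- `β(u) ∈ L²(0,T; H¹)`
    (∀ T : ℝ, 0 < T → MemLp G 2 (volume.restrict (Ioo 0 T))) ∧
    (∀ᵐ t ∂(volume.restrict (Ioi (0 : ℝ))), h1val (G t) =ᵐ[volume] fun x => β (u t x)) ∧
    -- `(D b(u) + K*u) u ∈ L²(0,T; L²)`
    (∀ T : ℝ, 0 < T → MemLp F 2 (volume.restrict (Ioo 0 T))) ∧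
    (∀ᵐ t ∂(volume.restrict (Ioi (0 : ℝ))),
      F t =ᵐ[volume] fun x => u t x • drift b D K (u t) x) ∧
    -- the equation
    (∀ᵐ t ∂(volume.restrict (Ioi (0 : ℝ))), ∀ φ : H1 d,
      U' t φ + inner ℝ (h1grad (G t) - F t) (h1grad φ) = 0) ∧
    -- the initial condition
    u 0 =ᵐ[volume] u₀

/-- The class in which the weak solution is unique: `u(t)` is a probability density for every
`t ≥ 0`, and `u ∈ L²(0,T; H¹) ∩ L^∞((0,T) × ℝᵈ)` for every `T > 0`. -/
def InSolutionClass {d : ℕ} (u : ℝ → Sp d → ℝ) : Prop :=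
  (∀ t, 0 ≤ t → IsProbDensity (u t)) ∧
  (∃ W : ℝ → H1 d, (∀ T : ℝ, 0 < T → MemLp W 2 (volume.restrict (Ioo 0 T))) ∧
    ∀ᵐ t ∂(volume.restrict (Ioi (0 : ℝ))), h1val (W t) =ᵐ[volume] u t) ∧
  ∀ T : ℝ, 0 < T → MemLp (fun z : ℝ × Sp d => u z.1 z.2) ∞ (cylMeasure d T)

/-! ### The frozen equation -/

/-- `v` is a distributional solution on `(0,T) × ℝᵈ` of the linear equation
`∂ₜv - Δ((β(u)/u) v) + div((D b(u) + K*u) v) = 0`. -/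
def IsFrozenSolution {d : ℕ} (β b : ℝ → ℝ) (D K : Sp d → Sp d) (T : ℝ)
    (u v : ℝ → Sp d → ℝ) : Prop :=
  LocallyIntegrableOn (fun z : ℝ × Sp d => v z.1 z.2) (cyl d T) volume ∧
  LocallyIntegrableOn (fun z : ℝ × Sp d => diffusivity β (u z.1 z.2) * v z.1 z.2)
    (cyl d T) volume ∧
  LocallyIntegrableOn (fun z : ℝ × Sp d => v z.1 z.2 • drift b D K (u z.1) z.2)
    (cyl d T) volume ∧
  ∀ φ : ℝ × Sp d → ℝ, IsTest (cyl d T) φ →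
    ∫ z, (v z.1 z.2 * deriv (fun s => φ (s, z.2)) z.1
        + diffusivity β (u z.1 z.2) * v z.1 z.2 * Δ (fun y => φ (z.1, y)) z.2
        + inner ℝ (v z.1 z.2 • drift b D K (u z.1) z.2) (gradient (fun y => φ (z.1, y)) z.2))
      ∂(cylMeasure d T) = 0

/-- `v₁` and `v₂` have the same weak initial datum:
`lim_{t ↓ 0} ess sup_{0 < s < t} |∫ (v₁(s,x) - v₂(s,x)) ψ(x) dx| = 0` for all test functions. -/
def SameWeakInitialDatum {d : ℕ} (v₁ v₂ : ℝ → Sp d → ℝ) : Prop :=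
  ∀ ψ : Sp d → ℝ, IsTest univ ψ →
    Tendsto (fun t : ℝ => essSup (fun s => ‖∫ x, (v₁ s x - v₂ s x) * ψ x‖ₑ)
      (volume.restrict (Ioo 0 t))) (𝓝[>] 0) (𝓝 0)

/-- The class `L¹((0,T) × ℝᵈ) ∩ L^∞((0,T) × ℝᵈ)`. -/
def MemL1Linf {d : ℕ} (T : ℝ) (v : ℝ → Sp d → ℝ) : Prop :=
  MemLp (fun z : ℝ × Sp d => v z.1 z.2) 1 (cylMeasure d T) ∧
  MemLp (fun z : ℝ × Sp d => v z.1 z.2) ∞ (cylMeasure d T)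

end FrozenFP

end

/-! With `u` frozen, the equation is linear and uniformly parabolic. By the mean value theorem
`β(u)/u = β'(c)` with `|c| ≤ |u|`, so on bounded `u` it lies between `α` and a constant. The drift
is bounded because `u(t)` has unit mass and is bounded, while `K` is integrable near the origin and
bounded away from it. Hence the difference `V` of two solutions satisfies `∂ₜV = ΔA - div B` with
zero initial datum, where `V A ≥ α V²` and `|A|, |B| ≤ C |V|`.

Uniqueness then follows from an energy estimate in `H⁻¹`, that is, from testing with `(1 - Δ)⁻¹ V`.
The diffusion gives `-2 ∫ V A ≤ -2 α ‖V‖²_{L²}`, up to terms of lower order; those and the drift are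
split by Young's inequality into `δ (‖A‖² + ‖B‖²)`, which the dissipation absorbs for small `δ`, and
a multiple of `‖V‖²_{H⁻¹}`. Gronwall's lemma gives `V = 0`.

That test function is not admissible directly, so the energy identity is proved frequency by
frequency. Testing with the real and imaginary parts of a character shows that the Fourier
coefficient of `V(t)` at `ξ` is almost everywhere a primitive in time
(`IsWeakNullSolution.pairing_bounded`). Its squared modulus is then differentiated
(`energy_identity`), weighted by `(1 + |2πξ|²)⁻¹` and integrated over `ξ`, and Plancherel's identity
returns the dissipation to physical space (`IsWeakNullSolution.ae_eq_zero`). -/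

namespace FrozenFP

/-! ### Plancherel's identity for functions in `L¹ ∩ L²` -/

section Plancherel

open scoped FourierTransform ComplexConjugate

variable {E : Type*} [NormedAddCommGroup E] [InnerProductSpace ℝ E] [FiniteDimensional ℝ E]
  [MeasurableSpace E] [BorelSpace E]

theorem continuous_fourier_of_integrable {f : E → ℂ} (hf : Integrable f) : Continuous (𝓕 f) :=
  VectorFourier.fourierIntegral_continuous (L := innerₗ E) Real.continuous_fourierChar
    continuous_inner hf

/-- The `L²` Fourier transform of a function in `L¹ ∩ L²` is given by the Fourier integral. -/
theorem fourier_toLp_ae_eq {f : E → ℂ} (h1 : Integrable f) (h2 : MemLp f 2 volume) :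
    (𝓕 (h2.toLp f) : Lp ℂ 2 (volume : Measure E)) =ᵐ[volume] 𝓕 f := by
  -- Both sides are locally integrable, so testing against smooth `g` suffices. There both
  -- transforms move onto `g`: the `L²` one by duality of tempered distributions, the integral one
  -- by Fubini.
  refine ae_eq_of_integral_contDiff_smul_eq ((Lp.memLp _).locallyIntegrable (by norm_num))
    (continuous_fourier_of_integrable h1).locallyIntegrable fun g hg hgc => ?_
  have hg₁ : HasCompactSupport (Complex.ofRealCLM ∘ g) := hgc.comp_left rfl
  have hg₂ : ContDiff ℝ ∞ (Complex.ofRealCLM ∘ g) := by fun_prop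
  set G : SchwartzMap E ℂ := hg₁.toSchwartzMap hg₂ with hG
  have hGx : ∀ x, G x = (g x : ℂ) := fun x => rfl
  have key := congrArg (fun S => S G) (Lp.fourier_toTemperedDistribution_eq (h2.toLp f))
  simp only [TemperedDistribution.fourier_apply, Lp.toTemperedDistribution_apply] at key
  have e1 : ∫ x, (𝓕 G) x • (h2.toLp f) x = ∫ x, (𝓕 G) x • f x :=
    integral_congr_ae (by filter_upwards [h2.coeFn_toLp] with x hx; rw [hx])
  have e2 : ∫ ξ, 𝓕 (G : E → ℂ) ξ • f ξ = ∫ x, G x • 𝓕 f x := by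
    simpa using! VectorFourier.integral_fourierIntegral_smul_eq_flip (L := innerₗ E)
      Real.continuous_fourierChar continuous_inner G.integrable h1
  calc ∫ x, g x • (𝓕 (h2.toLp f) : Lp ℂ 2 (volume : Measure E)) x
      = ∫ x, G x • (𝓕 (h2.toLp f) : Lp ℂ 2 (volume : Measure E)) x := by simp [hGx]
    _ = ∫ x, G x • 𝓕 f x := by rw [← key, e1, SchwartzMap.fourier_coe, e2]
    _ = ∫ x, g x • 𝓕 f x := by simp [hGx]

theorem memLp_fourier {f : E → ℂ} (h1 : Integrable f) (h2 : MemLp f 2 volume) :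
    MemLp (𝓕 f) 2 volume :=
  (memLp_congr_ae (fourier_toLp_ae_eq h1 h2)).1 (Lp.memLp _)

theorem integral_inner_fourier {f g : E → ℂ} (hf1 : Integrable f) (hf2 : MemLp f 2 volume)
    (hg1 : Integrable g) (hg2 : MemLp g 2 volume) :
    ∫ ξ, inner ℂ (𝓕 f ξ) (𝓕 g ξ) = ∫ x, inner ℂ (f x) (g x) := by
  have h := Lp.inner_fourier_eq (hf2.toLp f) (hg2.toLp g)
  rw [L2.inner_def, L2.inner_def] at h
  calc _ = _ := integral_congr_ae ?_
    _ = _ := h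
    _ = _ := integral_congr_ae ?_
  · filter_upwards [fourier_toLp_ae_eq hf1 hf2, fourier_toLp_ae_eq hg1 hg2] with x h1 h2
    rw [h1, h2]
  · filter_upwards [hf2.coeFn_toLp, hg2.coeFn_toLp] with x h1 h2
    rw [h1, h2]

/-- The Fourier transform of a real-valued function. -/
noncomputable def rfourier (f : E → ℝ) : E → ℂ := 𝓕 (fun x => (f x : ℂ))

theorem memLp_rfourier {f : E → ℝ} (h1 : Integrable f) (h2 : MemLp f 2 volume) :
    MemLp (rfourier f) 2 volume :=
  memLp_fourier h1.ofReal h2.ofReal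

/-- Plancherel's identity for real functions in `L¹ ∩ L²`. -/
theorem integral_re_conj_rfourier_mul {f g : E → ℝ} (hf1 : Integrable f) (hf2 : MemLp f 2 volume)
    (hg1 : Integrable g) (hg2 : MemLp g 2 volume) :
    ∫ ξ, (conj (rfourier f ξ) * rfourier g ξ).re = ∫ x, f x * g x := by
  have h := integral_inner_fourier hf1.ofReal hf2.ofReal hg1.ofReal hg2.ofReal
  have hint : Integrable fun ξ => conj (rfourier f ξ) * rfourier g ξ :=
    (memLp_rfourier hf1 hf2).star.integrable_mul (memLp_rfourier hg1 hg2)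
  have e2 : ∫ x, inner ℂ (f x : ℂ) (g x : ℂ) = ((∫ x, f x * g x : ℝ) : ℂ) := by
    rw [← integral_complex_ofReal]
    exact integral_congr_ae (ae_of_all _ fun x => by simp [RCLike.inner_apply, mul_comm])
  have e1 : ∫ ξ, conj (rfourier f ξ) * rfourier g ξ = ((∫ x, f x * g x : ℝ) : ℂ) := by
    rw [← e2]
    refine Eq.trans ?_ h
    exact integral_congr_ae (ae_of_all _ fun x => by
      simp [RCLike.inner_apply, mul_comm, rfourier])
  have e3 := integral_re hint
  simp only [RCLike.re_eq_complex_re] at e3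
  rw [e3, e1, Complex.ofReal_re]

theorem integral_norm_sq_rfourier {f : E → ℝ} (hf1 : Integrable f) (hf2 : MemLp f 2 volume) :
    ∫ ξ, ‖rfourier f ξ‖ ^ 2 = ∫ x, f x ^ 2 := by
  have := integral_re_conj_rfourier_mul hf1 hf2 hf1 hf2
  simp only [← pow_two (f _)] at this
  rw [← this]
  refine integral_congr_ae (ae_of_all _ fun ξ => ?_)
  simp only [Complex.conj_mul']
  norm_cast

end Plancherel

end FrozenFP

/-! ### Weak derivatives in time and Gronwall's lemma -/

namespace FrozenFP

/-- The primitive vanishes at `0` and `θ` at `T`, so integration by parts leaves no boundary term.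
-/
theorem integral_deriv_mul_primitive {T : ℝ} (hT : 0 < T) {h θ : ℝ → ℝ}
    (hh : IntegrableOn h (Ioo 0 T)) (hθ : IsTest (Ioo 0 T) θ) :
    ∫ t in Ioo 0 T, (∫ s in (0)..t, h s) * deriv θ t = - ∫ t in Ioo 0 T, h t * θ t := by
  have hi : IntervalIntegrable h volume 0 T := by
    rw [intervalIntegrable_iff_integrableOn_Ioo_of_le hT.le]; exact hh
  have hac := hi.absolutelyContinuousOnInterval_intervalIntegral (c := 0) (by simp)
  have hθac : AbsolutelyContinuousOnInterval θ 0 T :=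
    (hθ.1.of_le (by norm_num)).contDiffOn.absolutelyContinuousOnInterval
  have hθT : θ T = 0 := image_eq_zero_of_notMem_tsupport fun h => by simpa using hθ.2.2 h
  have key := hac.integral_mul_deriv_eq_deriv_mul hθac
  simp only [hθT, intervalIntegral.integral_same, mul_zero, zero_mul, sub_zero, zero_sub] at key
  rw [← integral_Ioc_eq_integral_Ioo, ← integral_Ioc_eq_integral_Ioo,
    ← intervalIntegral.integral_of_le hT.le, ← intervalIntegral.integral_of_le hT.le, key]
  congr 1
  refine intervalIntegral.integral_congr_ae ?_
  filter_upwards [hi.ae_hasDerivAt_integral] with x hx hx'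
  rw [(hx (uIoc_subset_uIcc hx') 0 (by simp)).deriv]

/-- A function with zero initial value whose weak derivative vanishes is zero. -/
theorem ae_eq_zero_of_weak_deriv_zero {T : ℝ} (hT : 0 < T) {p : ℝ → ℝ}
    (hp : IntegrableOn p (Ioo 0 T))
    (hw : ∀ θ : ℝ → ℝ, IsTest (Ioo 0 T) θ → ∫ t in Ioo 0 T, p t * deriv θ t = 0)
    (h0 : ∀ ε > 0, ∃ δ > 0, ∀ᵐ s ∂(volume.restrict (Ioo 0 δ)), |p s| ≤ ε) :
    ∀ᵐ t ∂(volume.restrict (Ioo 0 T)), p t = 0 := by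
  rw [ae_restrict_iff' measurableSet_Ioo]
  refine isOpen_Ioo.ae_eq_zero_of_integral_contDiff_smul_eq_zero hp.locallyIntegrableOn ?_
  intro η hη hηc hηs
  have hred : ∫ x, η x • p x = ∫ x in Ioo 0 T, p x * η x := by
    rw [← setIntegral_eq_integral_of_forall_compl_eq_zero (s := Ioo 0 T)]
    · exact integral_congr_ae (ae_of_all _ fun x => by simp [mul_comm])
    · intro x hx
      rw [image_eq_zero_of_notMem_tsupport fun h => hx (hηs h), zero_smul]
  rw [hred]
  set c : ℝ := ∫ x, η x with hc
  -- compare with a bump near the origin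
  refine abs_eq_zero.1 (le_antisymm (le_of_forall_pos_le_add fun ε hε => ?_) (abs_nonneg _))
  -- The `+ 1` keeps the denominator positive when `c = 0`.
  obtain ⟨δ, hδ, hpδ⟩ := h0 (ε / (|c| + 1)) (by positivity)
  set r : ℝ := min δ T / 2 with hr
  have hr0 : 0 < r := by positivity
  have hrδ : 2 * r ≤ δ := by rw [hr]; linarith [min_le_left δ T]
  have hrT : 2 * r ≤ T := by rw [hr]; linarith [min_le_right δ T]
  let ρb : ContDiffBump r := ⟨r / 4, r / 2, by positivity, by linarith⟩
  set ρ : ℝ → ℝ := ρb.normed volume with hρ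
  have hρ1 : ∫ x, ρ x = 1 := ρb.integral_normed
  have hρs : tsupport ρ = Metric.closedBall r (r / 2) := ρb.tsupport_normed_eq
  have hρc : ContDiff ℝ ∞ ρ := ρb.contDiff_normed
  have hρcs : HasCompactSupport ρ := ρb.hasCompactSupport_normed
  have hρsub : tsupport ρ ⊆ Ioo 0 (2 * r) := by
    rw [hρs, Real.closedBall_eq_Icc]
    exact fun x hx => ⟨by linarith [hx.1], by linarith [hx.2]⟩
  have hρsT : tsupport ρ ⊆ Ioo 0 T := hρsub.trans (Ioo_subset_Ioo_right hrT)
  -- Subtracting a bump of the same mass makes `q` the derivative of a test function, so `∫ p η = c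
  -- ∫ p ρ`; the bump sits in `(0, δ)`, where `p` is small.
  let q : ℝ → ℝ := fun x => η x - c * ρ x
  have hqc : ContDiff ℝ ∞ q := hη.sub (contDiff_const.mul hρc)
  have hqi : ∫ x, q x = 0 := by
    rw [integral_sub (hη.continuous.integrable_of_hasCompactSupport hηc)
      ((hρc.continuous.integrable_of_hasCompactSupport hρcs).const_mul c),
      integral_const_mul, hρ1]
    simp [hc]
  obtain ⟨a, b, ha, hab, hbT, hsupp⟩ : ∃ a b, 0 < a ∧ a ≤ b ∧ b < T ∧
      ∀ x, x ∉ Icc a b → q x = 0 := by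
    have hK : IsCompact (tsupport η ∪ tsupport ρ) := hηc.isCompact.union hρcs.isCompact
    have hKne : (tsupport η ∪ tsupport ρ).Nonempty :=
      ⟨r, Or.inr (by rw [hρs]; exact Metric.mem_closedBall_self (by positivity))⟩
    have hKs : tsupport η ∪ tsupport ρ ⊆ Ioo 0 T := union_subset hηs hρsT
    refine ⟨sInf (tsupport η ∪ tsupport ρ), sSup (tsupport η ∪ tsupport ρ),
      (hKs (hK.sInf_mem hKne)).1, ?_, (hKs (hK.sSup_mem hKne)).2, ?_⟩
    · exact csInf_le_csSup hKne hK.bddBelow hK.bddAbove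
    · intro x hx
      have hxK : x ∉ tsupport η ∪ tsupport ρ := fun h =>
        hx ⟨csInf_le hK.bddBelow h, le_csSup hK.bddAbove h⟩
      simp only [mem_union, not_or] at hxK
      simp [q, image_eq_zero_of_notMem_tsupport hxK.1, image_eq_zero_of_notMem_tsupport hxK.2]
  have hqcont : Continuous q := hqc.continuous
  let θ : ℝ → ℝ := fun t => ∫ s in (0)..t, q s
  have hθd : ∀ t, HasDerivAt θ (q t) t := fun t =>
    intervalIntegral.integral_hasDerivAt_right (hqcont.intervalIntegrable _ _)
      (hqcont.stronglyMeasurableAtFilter _ _) hqcont.continuousAt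
  have hθderiv : deriv θ = q := funext fun t => (hθd t).deriv
  have hθc : ContDiff ℝ ∞ θ := by
    rw [contDiff_infty_iff_deriv]
    exact ⟨fun t => (hθd t).differentiableAt, hθderiv ▸ hqc⟩
  have hqint : Integrable q := (hη.continuous.integrable_of_hasCompactSupport hηc).sub
      ((hρc.continuous.integrable_of_hasCompactSupport hρcs).const_mul c)
  -- To the left of `a` the integrand vanishes; to the right of `b` the primitive is the total mass
  -- of `q`, which is zero.
  have hθ0 : ∀ x, x ∉ Icc a b → θ x = 0 := by
    intro x hx
    rw [mem_Icc, not_and_or, not_le, not_le] at hx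
    rcases hx with hx | hx
    · refine (intervalIntegral.integral_congr_ae (ae_of_all _ fun s hs => ?_)).trans
        intervalIntegral.integral_zero
      apply hsupp
      intro h
      have : s ≤ max 0 x := hs.2
      have h2 := h.1
      rcases max_cases 0 x with h3 | h3 <;> linarith
    · have h1 : θ x = ∫ s in Ioc 0 x, q s :=
        intervalIntegral.integral_of_le (by linarith)
      rw [h1, ← hqi]
      refine setIntegral_eq_integral_of_forall_compl_eq_zero fun s hs => hsupp s fun h => hs ?_
      exact ⟨by linarith [h.1], by linarith [h.2]⟩
  have hθts : tsupport θ ⊆ Icc a b :=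
    closure_minimal (fun x hx => by_contra fun h => hx (hθ0 x h)) isClosed_Icc
  have hθtest : IsTest (Ioo 0 T) θ :=
    ⟨hθc, isCompact_Icc.of_isClosed_subset (isClosed_tsupport _) hθts,
      hθts.trans fun x hx => ⟨by linarith [hx.1], by linarith [hx.2]⟩⟩
  have hw' := hw θ hθtest
  rw [hθderiv] at hw'
  have hbd : ∀ {g : ℝ → ℝ}, Continuous g → HasCompactSupport g →
      IntegrableOn (fun x => p x * g x) (Ioo 0 T) := by
    intro g hg hgc
    obtain ⟨M, hM⟩ := hg.bounded_above_of_compact_support hgc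
    exact Integrable.mul_bdd (c := M) hp hg.aestronglyMeasurable (ae_of_all _ hM)
  have hsplit : ∫ x in Ioo 0 T, p x * η x = c * ∫ x in Ioo 0 T, p x * ρ x := by
    have : ∫ x in Ioo 0 T, p x * q x
        = (∫ x in Ioo 0 T, p x * η x) - c * ∫ x in Ioo 0 T, p x * ρ x := by
      rw [← integral_const_mul, ← integral_sub (hbd hη.continuous hηc)
        ((hbd hρc.continuous hρcs).const_mul c)]
      exact integral_congr_ae (ae_of_all _ fun x => by simp only [q]; ring)
    linarith
  have hle : |∫ x in Ioo 0 T, p x * ρ x| ≤ ε / (|c| + 1) := by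
    have hρint := hρc.continuous.integrable_of_hasCompactSupport (μ := volume) hρcs
    calc |∫ x in Ioo 0 T, p x * ρ x| ≤ ∫ x in Ioo 0 T, ε / (|c| + 1) * ρ x := by
          rw [← Real.norm_eq_abs]
          refine norm_integral_le_of_norm_le (hρint.restrict.const_mul _) ?_
          rw [ae_restrict_iff' measurableSet_Ioo] at hpδ ⊢
          filter_upwards [hpδ] with x hx _
          by_cases hxδ : x ∈ Ioo 0 δ
          · rw [norm_mul, Real.norm_of_nonneg (ρb.nonneg_normed x)]
            exact mul_le_mul_of_nonneg_right (hx hxδ) (ρb.nonneg_normed x)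
          · have : ρ x = 0 := image_eq_zero_of_notMem_tsupport fun h =>
              hxδ ⟨(hρsub h).1, (hρsub h).2.trans_le hrδ⟩
            simp [this]
      _ ≤ ε / (|c| + 1) := by
          rw [integral_const_mul, setIntegral_eq_integral_of_forall_compl_eq_zero, hρ1, mul_one]
          exact fun x hx => image_eq_zero_of_notMem_tsupport fun h => hx (hρsT h)
  rw [hsplit, abs_mul, zero_add]
  calc |c| * |∫ x in Ioo 0 T, p x * ρ x| ≤ |c| * (ε / (|c| + 1)) := by gcongr
    _ ≤ ε := by
      rw [mul_div_assoc', div_le_iff₀ (by positivity)]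
      nlinarith [abs_nonneg c]

/-- The difference of `m` and the primitive of `h` has zero weak derivative, and its initial value
is zero because the primitive is continuous at `0`. -/
theorem ae_eq_primitive_of_weak_deriv {T : ℝ} (hT : 0 < T) {m h : ℝ → ℝ}
    (hm : IntegrableOn m (Ioo 0 T)) (hh : IntegrableOn h (Ioo 0 T))
    (hw : ∀ θ : ℝ → ℝ, IsTest (Ioo 0 T) θ →
      ∫ t in Ioo 0 T, m t * deriv θ t + h t * θ t = 0)
    (h0 : ∀ ε > 0, ∃ δ > 0, ∀ᵐ s ∂(volume.restrict (Ioo 0 δ)), |m s| ≤ ε) :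
    ∀ᵐ t ∂(volume.restrict (Ioo 0 T)), m t = ∫ s in (0)..t, h s := by
  have hi : IntervalIntegrable h volume 0 T := by
    rw [intervalIntegrable_iff_integrableOn_Ioo_of_le hT.le]; exact hh
  have hcont : ContinuousOn (fun t => ∫ s in (0)..t, h s) (Icc 0 T) := by
    simpa [uIcc_of_le hT.le] using
      (hi.absolutelyContinuousOnInterval_intervalIntegral (c := 0) (by simp)).continuousOn
  have hPi : IntegrableOn (fun t => ∫ s in (0)..t, h s) (Ioo 0 T) :=
    hcont.integrableOn_Icc.mono_set Ioo_subset_Icc_self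
  have hbd : ∀ {f g : ℝ → ℝ}, IntegrableOn f (Ioo 0 T) → Continuous g → HasCompactSupport g →
      IntegrableOn (fun x => f x * g x) (Ioo 0 T) := by
    intro f g hf hg hgc
    obtain ⟨M, hM⟩ := hg.bounded_above_of_compact_support hgc
    exact Integrable.mul_bdd (c := M) hf hg.aestronglyMeasurable (ae_of_all _ hM)
  have key := ae_eq_zero_of_weak_deriv_zero hT (p := fun t => m t - ∫ s in (0)..t, h s)
    (hm.sub hPi) ?_ ?_
  · filter_upwards [key] with t ht
    linarith
  · intro θ hθ
    have hd : Continuous (deriv θ) := hθ.1.continuous_deriv (by simp)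
    have hdc : HasCompactSupport (deriv θ) := hθ.2.1.deriv
    have h1 := hw θ hθ
    rw [integral_add (hbd hm hd hdc) (hbd hh hθ.1.continuous hθ.2.1)] at h1
    have h2 := integral_deriv_mul_primitive hT hh hθ
    simp only [sub_mul]
    rw [integral_sub (hbd hm hd hdc) (hbd hPi hd hdc)]
    linarith
  · intro ε hε
    obtain ⟨δ₁, hδ₁, h1⟩ := h0 (ε / 2) (by positivity)
    have hc0 : Tendsto (fun t => ∫ s in (0)..t, h s) (𝓝[Icc 0 T] 0) (𝓝 0) := by
      simpa [ContinuousWithinAt] using hcont 0 ⟨le_rfl, hT.le⟩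
    obtain ⟨δ₂, hδ₂, h2⟩ := Metric.tendsto_nhdsWithin_nhds.1 hc0 (ε / 2) (by positivity)
    refine ⟨min δ₁ (min δ₂ T), by positivity, ?_⟩
    rw [ae_restrict_iff' measurableSet_Ioo] at h1 ⊢
    filter_upwards [h1] with s hs hs'
    have ha := hs ⟨hs'.1, hs'.2.trans_le (min_le_left _ _)⟩
    have hb := h2 (x := s) ⟨hs'.1.le, hs'.2.le.trans ((min_le_right _ _).trans (min_le_right _ _))⟩
      (by
        rw [Real.dist_eq, sub_zero, abs_of_pos hs'.1]
        exact hs'.2.trans_le ((min_le_right _ _).trans (min_le_left _ _)))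
    rw [Real.dist_eq, sub_zero] at hb
    exact (abs_sub _ _).trans (by linarith)

theorem primitive_sq {T : ℝ} {h : ℝ → ℝ} (hh : IntegrableOn h (Ioo 0 T)) {t : ℝ}
    (ht : t ∈ Ioo 0 T) :
    (∫ s in (0)..t, h s) ^ 2 = ∫ s in (0)..t, 2 * ((∫ r in (0)..s, h r) * h s) := by
  have hi : IntervalIntegrable h volume 0 t := by
    rw [intervalIntegrable_iff_integrableOn_Ioo_of_le ht.1.le]
    exact hh.mono_set (Ioo_subset_Ioo_right ht.2.le)
  have hac := hi.absolutelyContinuousOnInterval_intervalIntegral (c := 0) (by simp)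
  have key := hac.integral_deriv_mul_eq_sub hac
  simp only [intervalIntegral.integral_same, mul_zero, sub_zero] at key
  rw [pow_two, ← key]
  refine intervalIntegral.integral_congr_ae ?_
  filter_upwards [hi.ae_hasDerivAt_integral] with x hx hx'
  rw [(hx (uIoc_subset_uIcc hx') 0 (by simp)).deriv]
  ring

theorem sq_ae_eq_primitive {T : ℝ} {m h : ℝ → ℝ} (hh : IntegrableOn h (Ioo 0 T))
    (hm : ∀ᵐ t ∂(volume.restrict (Ioo 0 T)), m t = ∫ s in (0)..t, h s) :
    ∀ᵐ t ∂(volume.restrict (Ioo 0 T)), m t ^ 2 = ∫ s in Ioo 0 t, 2 * (m s * h s) := by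
  rw [ae_restrict_iff' measurableSet_Ioo] at hm ⊢
  filter_upwards [hm] with t ht htT
  rw [ht htT, primitive_sq hh htT, ← integral_Ioc_eq_integral_Ioo,
    ← intervalIntegral.integral_of_le htT.1.le]
  refine intervalIntegral.integral_congr_ae ?_
  filter_upwards [hm] with s hs hs'
  rw [uIoc_of_le htT.1.le] at hs'
  rw [hs ⟨hs'.1, hs'.2.trans_lt htT.2⟩]

theorem integrableOn_mul_of_ae_eq_primitive {T : ℝ} (hT : 0 < T) {m h : ℝ → ℝ}
    (hh : IntegrableOn h (Ioo 0 T))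
    (hm : ∀ᵐ t ∂(volume.restrict (Ioo 0 T)), m t = ∫ s in (0)..t, h s) :
    IntegrableOn (fun t => m t * h t) (Ioo 0 T) := by
  have hi : IntervalIntegrable h volume 0 T := by
    rw [intervalIntegrable_iff_integrableOn_Ioo_of_le hT.le]; exact hh
  have hcont : ContinuousOn (fun t => ∫ s in (0)..t, h s) (Icc 0 T) := by
    simpa [uIcc_of_le hT.le] using
      (hi.absolutelyContinuousOnInterval_intervalIntegral (c := 0) (by simp)).continuousOn
  obtain ⟨M, hM⟩ := isCompact_Icc.exists_bound_of_continuousOn hcont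
  refine Integrable.bdd_mul (c := M) hh ?_ ?_
  · exact ((hcont.mono Ioo_subset_Icc_self).aestronglyMeasurable measurableSet_Ioo).congr
      (by filter_upwards [hm] with t ht using ht.symm)
  · filter_upwards [hm, ae_restrict_mem measurableSet_Ioo] with t ht htT
    rw [ht]
    exact hM t (Ioo_subset_Icc_self htT)

/-- Gronwall's lemma for an integral inequality holding almost everywhere. -/
theorem ae_eq_zero_of_le_integral {T c : ℝ} {G : ℝ → ℝ}
    (hG : IntegrableOn G (Ioo 0 T)) (hG0 : ∀ t, 0 ≤ G t)
    (hle : ∀ᵐ t ∂(volume.restrict (Ioo 0 T)), G t ≤ c * ∫ s in Ioo 0 t, G s) :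
    ∀ᵐ t ∂(volume.restrict (Ioo 0 T)), G t = 0 := by
  rcases le_or_gt T 0 with hT | hT
  · simp [Ioo_eq_empty_of_le hT]
  have hi : IntervalIntegrable G volume 0 T := by
    rw [intervalIntegrable_iff_integrableOn_Ioo_of_le hT.le]; exact hG
  set H : ℝ → ℝ := fun t => ∫ s in (0)..t, G s with hH
  have hHac : AbsolutelyContinuousOnInterval H 0 T :=
    hi.absolutelyContinuousOnInterval_intervalIntegral (c := 0) (by simp)
  -- Integrating factor: `(H e)' = (G - c H) e ≤ 0` almost everywhere and `H 0 = 0`, so `H ≤ 0`,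
  -- while `G ≥ 0` gives `H ≥ 0`. The sign of `c` plays no role.
  set e : ℝ → ℝ := fun t => Real.exp (-c * t) with he
  have heac : AbsolutelyContinuousOnInterval e 0 T :=
    ContDiff.contDiffOn (by fun_prop) |>.absolutelyContinuousOnInterval
  have hed : ∀ t, deriv e t = -c * e t := fun t => by
    have : HasDerivAt e (Real.exp (-c * t) * (-c * 1)) t :=
      ((hasDerivAt_id t).const_mul (-c)).exp
    rw [this.deriv, he]; ring
  have hHn : ∀ t, 0 ≤ t → 0 ≤ H t := fun t ht =>
    intervalIntegral.integral_nonneg ht fun s _ => hG0 s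
  have hHeq : ∀ t, 0 ≤ t → H t = ∫ s in Ioo 0 t, G s := fun t ht => by
    rw [hH, ← integral_Ioc_eq_integral_Ioo, ← intervalIntegral.integral_of_le ht]
  rw [ae_restrict_iff' measurableSet_Ioo] at hle
  have hH0 : ∀ t ∈ Ioo 0 T, H t = 0 := by
    intro t ht
    have hsub : uIcc 0 t ⊆ uIcc 0 T := by
      rw [uIcc_of_le ht.1.le, uIcc_of_le hT.le]; exact Icc_subset_Icc_right ht.2.le
    have key := (hHac.mono hsub).integral_deriv_mul_eq_sub (heac.mono hsub)
    have h0 : H 0 = 0 := by simp [hH]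
    rw [h0, zero_mul, sub_zero] at key
    have hneg : ∫ x in (0)..t, deriv H x * e x + H x * deriv e x ≤ 0 := by
      rw [intervalIntegral.integral_of_le ht.1.le]
      refine integral_nonpos_of_ae ?_
      rw [EventuallyLE, ae_restrict_iff' measurableSet_Ioc]
      filter_upwards [hi.ae_hasDerivAt_integral, hle] with x hx hx' hxt
      have hxT : x ∈ Ioo 0 T := ⟨hxt.1, hxt.2.trans_lt ht.2⟩
      have hd : HasDerivAt H (G x) x :=
        hx (by rw [uIcc_of_le hT.le]; exact Ioo_subset_Icc_self hxT) 0 (by simp)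
      rw [hd.deriv, hed]
      have h1 := hx' hxT
      rw [← hHeq x hxt.1.le] at h1
      have h2 : 0 ≤ e x := (Real.exp_pos _).le
      simp only [Pi.zero_apply]
      nlinarith
    have h2 : 0 < e t := Real.exp_pos _
    have h3 := hHn t ht.1.le
    nlinarith [key ▸ hneg]
  rw [ae_restrict_iff' measurableSet_Ioo]
  filter_upwards [hle] with t ht htT
  have := ht htT
  rw [← hHeq t htT.1.le, hH0 t htT, mul_zero] at this
  exact le_antisymm this (hG0 t)

end FrozenFP

/-! ### Test functions with bounded derivatives -/

namespace FrozenFP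

variable {d : ℕ}

theorem cylMeasure_eq_prod (d : ℕ) (T : ℝ) :
    cylMeasure d T = (volume.restrict (Ioo 0 T)).prod volume := by
  rw [cylMeasure, cyl, Measure.volume_eq_prod, ← Measure.prod_restrict, Measure.restrict_univ]

/-- Smooth functions whose derivatives up to order two are bounded by `C`. -/
def SmoothBounded (C : ℝ) (ψ : Sp d → ℝ) : Prop :=
  ContDiff ℝ ∞ ψ ∧ ∀ k ≤ 2, ∀ x, ‖iteratedFDeriv ℝ k ψ x‖ ≤ C

namespace SmoothBounded

variable {C : ℝ} {ψ : Sp d → ℝ}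

theorem nonneg (h : SmoothBounded C ψ) : 0 ≤ C := (norm_nonneg _).trans (h.2 0 (by norm_num) 0)

theorem norm_le (h : SmoothBounded C ψ) (x : Sp d) : ‖ψ x‖ ≤ C := by
  simpa using h.2 0 (by norm_num) x

theorem norm_gradient_le (h : SmoothBounded C ψ) (x : Sp d) : ‖gradient ψ x‖ ≤ C := by
  have := h.2 1 (by norm_num) x
  rw [norm_iteratedFDeriv_one] at this
  rwa [gradient, LinearIsometryEquiv.norm_map]

theorem norm_laplacian_le (h : SmoothBounded C ψ) (x : Sp d) : ‖Δ ψ x‖ ≤ d * C := by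
  rw [InnerProductSpace.laplacian_eq_iteratedFDeriv_orthonormalBasis ψ
    (EuclideanSpace.basisFun (Fin d) ℝ)]
  calc _ ≤ ∑ _i : Fin d, C := by
        refine norm_sum_le_of_le _ fun i _ => ?_
        refine ((iteratedFDeriv ℝ 2 ψ x).le_opNorm _).trans ?_
        have : ∏ j : Fin 2, ‖(![EuclideanSpace.basisFun (Fin d) ℝ i,
          EuclideanSpace.basisFun (Fin d) ℝ i] : Fin 2 → Sp d) j‖ = 1 := by
          simp [Fin.prod_univ_two]
        rw [this, mul_one]
        exact h.2 2 le_rfl x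
    _ = d * C := by simp

end SmoothBounded

theorem continuous_gradient {ψ : Sp d → ℝ} (h : ContDiff ℝ ∞ ψ) : Continuous (gradient ψ) :=
  (InnerProductSpace.toDual ℝ (Sp d)).symm.continuous.comp (h.continuous_fderiv (by simp))

theorem continuous_laplacian {ψ : Sp d → ℝ} (h : ContDiff ℝ ∞ ψ) : Continuous (Δ ψ) := by
  rw [InnerProductSpace.laplacian_eq_iteratedFDeriv_orthonormalBasis ψ
    (EuclideanSpace.basisFun (Fin d) ℝ)]
  refine continuous_finsetSum _ fun i _ => ?_
  have hk (k : ℕ) : Continuous (iteratedFDeriv ℝ k ψ) :=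
    h.continuous_iteratedFDeriv (m := k) (by exact_mod_cast le_top)
  exact (ContinuousMultilinearMap.apply ℝ (fun _ : Fin 2 => Sp d) ℝ _).continuous.comp (hk 2)

theorem IsTest.smoothBounded {ψ : Sp d → ℝ} (h : IsTest univ ψ) : ∃ C, SmoothBounded C ψ := by
  have : ∀ k : ℕ, ∃ C, ∀ x, ‖iteratedFDeriv ℝ k ψ x‖ ≤ C := fun k =>
    (h.1.continuous_iteratedFDeriv (m := k) (by exact_mod_cast le_top)).bounded_above_of_compact_support
      (h.2.1.iteratedFDeriv k)
  choose C hC using this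
  refine ⟨max (C 0) (max (C 1) (C 2)), h.1, fun k hk x => (hC k x).trans ?_⟩
  interval_cases k <;> simp

/-- Leibniz's rule; the binomial coefficients sum to `2 ^ k ≤ 4` for `k ≤ 2`. -/
theorem SmoothBounded.mul {C₁ C₂ : ℝ} {ψ₁ ψ₂ : Sp d → ℝ} (h₁ : SmoothBounded C₁ ψ₁)
    (h₂ : SmoothBounded C₂ ψ₂) : SmoothBounded (4 * (C₁ * C₂)) (fun x => ψ₁ x * ψ₂ x) := by
  refine ⟨h₁.1.mul h₂.1, fun k hk x => ?_⟩
  have h0 : 0 ≤ C₁ * C₂ := mul_nonneg h₁.nonneg h₂.nonneg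
  refine (norm_iteratedFDeriv_mul_le h₁.1 h₂.1 x (n := k) (by exact_mod_cast le_top)).trans ?_
  calc _ ≤ ∑ i ∈ Finset.range (k + 1), (k.choose i : ℝ) * (C₁ * C₂) := by
        refine Finset.sum_le_sum fun i hi => ?_
        have hi' : i ≤ k := Nat.lt_succ_iff.1 (Finset.mem_range.1 hi)
        rw [mul_assoc]
        gcongr
        · exact h₁.nonneg
        · exact h₁.2 i (hi'.trans hk) x
        · exact h₂.2 (k - i) (by omega) x
    _ = 2 ^ k * (C₁ * C₂) := by
        rw [← Finset.sum_mul]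
        congr 1
        exact_mod_cast Nat.sum_range_choose k
    _ ≤ 4 * (C₁ * C₂) := by
        gcongr
        interval_cases k <;> norm_num

/-- Smooth functions with bounded derivatives are approximated by test functions. -/
theorem SmoothBounded.exists_test_approx {C : ℝ} {ψ : Sp d → ℝ} (h : SmoothBounded C ψ) :
    ∃ (C' : ℝ) (ψs : ℕ → Sp d → ℝ), (∀ n, IsTest univ (ψs n)) ∧ (∀ n, SmoothBounded C' (ψs n)) ∧
      ∀ x, ∀ᶠ n in atTop, ψs n =ᶠ[𝓝 x] ψ := by
  let χ : ContDiffBump (0 : Sp d) := ⟨1, 2, by norm_num, by norm_num⟩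
  have hχ : IsTest univ (χ : Sp d → ℝ) := ⟨χ.contDiff, χ.hasCompactSupport, subset_univ _⟩
  obtain ⟨C₁, hC₁⟩ := hχ.smoothBounded
  -- The cutoffs are `χ(x / (n + 1))`. Dilations of norm at most one do not increase the bounds on
  -- derivatives, which makes `C'` independent of `n`.
  let L : ℕ → (Sp d →L[ℝ] Sp d) := fun n => ((n : ℝ) + 1)⁻¹ • ContinuousLinearMap.id ℝ (Sp d)
  have hL : ∀ n, ‖L n‖ ≤ 1 := fun n => by
    refine ContinuousLinearMap.opNorm_le_bound _ zero_le_one fun x => ?_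
    have : ‖((n : ℝ) + 1)⁻¹‖ ≤ 1 := by
      rw [Real.norm_of_nonneg (by positivity)]
      exact inv_le_one_of_one_le₀ (by linarith [n.cast_nonneg (α := ℝ)])
    simp only [L, _root_.smul_apply, ContinuousLinearMap.id_apply, norm_smul]
    gcongr
  have hχn : ∀ n, SmoothBounded C₁ (χ ∘ L n) := fun n => by
    refine ⟨hχ.1.comp (L n).contDiff, fun k hk x => ?_⟩
    rw [(L n).iteratedFDeriv_comp_right hχ.1 x (i := k) (by exact_mod_cast le_top)]
    refine (ContinuousMultilinearMap.norm_compContinuousLinearMap_le _ _).trans ?_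
    refine (mul_le_of_le_one_right (norm_nonneg _) ?_).trans (hC₁.2 k hk _)
    exact Finset.prod_le_one (fun _ _ => norm_nonneg _) fun _ _ => hL n
  refine ⟨4 * (C₁ * C), fun n x => (χ ∘ L n) x * ψ x, fun n => ?_, fun n => (hχn n).mul h,
    fun x => ?_⟩
  · refine ⟨(hχn n).1.mul h.1, HasCompactSupport.mul_right ?_, subset_univ _⟩
    exact χ.hasCompactSupport.comp_homeomorph (Homeomorph.smulOfNeZero (((n : ℝ) + 1)⁻¹) (by positivity))
  · filter_upwards [eventually_gt_atTop (Nat.ceil ‖x‖)] with n hn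
    have hn' : ‖x‖ < (n : ℝ) + 1 := (Nat.le_ceil _).trans_lt (by exact_mod_cast hn.trans (Nat.lt_succ_self n))
    have : ∀ᶠ y in 𝓝 x, ‖y‖ < (n : ℝ) + 1 := continuous_norm.continuousAt.eventually_lt_const hn'
    filter_upwards [this] with y hy
    have : χ (L n y) = 1 := by
      refine χ.one_of_mem_closedBall ?_
      rw [mem_closedBall_zero_iff]
      simp only [L, _root_.smul_apply, ContinuousLinearMap.id_apply, norm_smul]
      rw [Real.norm_of_nonneg (by positivity), inv_mul_le_iff₀ (by positivity)]
      simpa [χ] using hy.le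
    simp [this]

/-! ### Phase-shifted cosines as test functions -/

section Trig

variable (η : Sp d) (θ : ℝ)

theorem iteratedFDeriv_cos_inner (k : ℕ) (x : Sp d) :
    iteratedFDeriv ℝ k (fun y : Sp d => Real.cos (inner ℝ η y + θ)) x
      = (iteratedFDeriv ℝ k (fun s => Real.cos (s + θ)) (inner ℝ η x)).compContinuousLinearMap
        fun _ => innerSL ℝ η :=
  (innerSL ℝ η).iteratedFDeriv_comp_right (f := fun s => Real.cos (s + θ)) (n := ∞)
    (by fun_prop) x (by exact_mod_cast le_top)

/-- The derivative of order `k` is at most `‖η‖ ^ k`, and `‖η‖` lies below the larger of `1` and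
`‖η‖ ^ 2`. The phases `0` and `π / 2` give the real and imaginary parts of `exp(-i η·x)`. -/
theorem smoothBounded_cos_inner :
    SmoothBounded (max 1 (‖η‖ ^ 2)) (fun y : Sp d => Real.cos (inner ℝ η y + θ)) := by
  refine ⟨Real.contDiff_cos.comp ((innerSL ℝ η).contDiff.add contDiff_const), fun k hk x => ?_⟩
  rw [iteratedFDeriv_cos_inner]
  refine (ContinuousMultilinearMap.norm_compContinuousLinearMap_le _ _).trans ?_
  rw [norm_iteratedFDeriv_eq_norm_iteratedDeriv, iteratedDeriv_comp_add_const]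
  have h1 : ‖iteratedDeriv k Real.cos (inner ℝ η x + θ)‖ ≤ 1 :=
    Real.abs_iteratedDeriv_cos_le_one _ _
  refine (mul_le_of_le_one_left (Finset.prod_nonneg fun _ _ => norm_nonneg _) h1).trans ?_
  simp only [innerSL_apply_norm, Finset.prod_const, Finset.card_univ, Fintype.card_fin]
  interval_cases k
  · simp
  · rcases le_total ‖η‖ 1 with h | h
    · simp [h]
    · exact le_max_of_le_right (by nlinarith)
  · simp

theorem gradient_cos_inner (x : Sp d) :
    gradient (fun y : Sp d => Real.cos (inner ℝ η y + θ)) x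
      = (-Real.sin (inner ℝ η x + θ)) • η := by
  refine HasGradientAt.gradient ?_
  rw [hasGradientAt_iff_hasFDerivAt]
  have h1 : HasFDerivAt (fun y : Sp d => inner ℝ η y + θ) (innerSL ℝ η) x :=
    (innerSL ℝ η).hasFDerivAt.add_const θ
  convert! h1.cos using 1
  ext y
  simp

theorem laplacian_cos_inner (x : Sp d) :
    Δ (fun y : Sp d => Real.cos (inner ℝ η y + θ)) x
      = -(‖η‖ ^ 2 * Real.cos (inner ℝ η x + θ)) := by
  rw [InnerProductSpace.laplacian_eq_iteratedFDeriv_orthonormalBasis _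
    (EuclideanSpace.basisFun (Fin d) ℝ)]
  have h2 : ∀ s, iteratedDeriv 2 (fun s => Real.cos (s + θ)) s = -Real.cos (s + θ) := fun s => by
    rw [iteratedDeriv_comp_add_const]
    simp [iteratedDeriv_succ]
  have h3 : ∀ (s : ℝ) (m : Fin 2 → ℝ), iteratedFDeriv ℝ 2 (fun s => Real.cos (s + θ)) s m
      = (m 0 * m 1) * -Real.cos (s + θ) := fun s m => by
    rw [iteratedFDeriv_apply_eq_iteratedDeriv_mul_prod, h2, Fin.prod_univ_two, smul_eq_mul]
  simp only [iteratedFDeriv_cos_inner, ContinuousMultilinearMap.compContinuousLinearMap_apply, h3]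
  rw [← Finset.sum_mul, EuclideanSpace.norm_sq_eq]
  simp [EuclideanSpace.inner_single_right, ← pow_two]

end Trig

end FrozenFP

/-! ### Pairings of a weak solution with a fixed spatial function -/

namespace FrozenFP

variable {d : ℕ} {T : ℝ} {V A : ℝ × Sp d → ℝ} {B : ℝ × Sp d → Sp d}

/-- The spatial part of the weak formulation at time `s`. -/
noncomputable def spatialPairing (A : ℝ × Sp d → ℝ) (B : ℝ × Sp d → Sp d) (ψ : Sp d → ℝ) (s : ℝ) :
    ℝ :=
  ∫ x, A (s, x) * Δ ψ x + inner ℝ (B (s, x)) (gradient ψ x)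

/-- `V` solves `∂ₜV = ΔA - div B` on `(0,T) × ℝᵈ` in the weak sense, with zero initial datum;
only products `θ(t)ψ(x)` are used as test functions. -/
structure IsWeakNullSolution (T : ℝ) (V A : ℝ × Sp d → ℝ) (B : ℝ × Sp d → Sp d) : Prop where
  integrable_V : Integrable V (cylMeasure d T)
  integrable_A : Integrable A (cylMeasure d T)
  integrable_B : Integrable B (cylMeasure d T)
  weak : ∀ (θ : ℝ → ℝ) (ψ : Sp d → ℝ), IsTest (Ioo 0 T) θ → IsTest univ ψ →
    ∫ z, (V z * (deriv θ z.1 * ψ z.2)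
      + θ z.1 * (A z * Δ ψ z.2 + inner ℝ (B z) (gradient ψ z.2))) ∂(cylMeasure d T) = 0
  init : ∀ ψ : Sp d → ℝ, IsTest univ ψ → ∀ ε > 0, ∃ δ > 0,
    ∀ᵐ s ∂(volume.restrict (Ioo 0 δ)), |∫ x, V (s, x) * ψ x| ≤ ε

theorem integrable_mul_bounded (hV : Integrable V (cylMeasure d T)) {C : ℝ} {ψ : Sp d → ℝ}
    (hψ : SmoothBounded C ψ) : Integrable (fun z => V z * ψ z.2) (cylMeasure d T) :=
  hV.mul_bdd (c := C) (hψ.1.continuous.comp continuous_snd).aestronglyMeasurable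
    (ae_of_all _ fun z => hψ.norm_le z.2)

theorem integrable_mul_time {f : ℝ × Sp d → ℝ} {g : ℝ → ℝ} (hf : Integrable f (cylMeasure d T))
    (hg : Continuous g) (hgc : HasCompactSupport g) :
    Integrable (fun z => f z * g z.1) (cylMeasure d T) := by
  obtain ⟨M, hM⟩ := hg.bounded_above_of_compact_support hgc
  exact hf.mul_bdd (c := M) (hg.comp continuous_fst).aestronglyMeasurable
    (ae_of_all _ fun z => hM z.1)

theorem norm_spatial_integrand_le {C : ℝ} {ψ : Sp d → ℝ} (hψ : SmoothBounded C ψ) (z : ℝ × Sp d) :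
    ‖A z * Δ ψ z.2 + inner ℝ (B z) (gradient ψ z.2)‖ ≤ (d + 1) * C * (‖A z‖ + ‖B z‖) := by
  refine (norm_add_le _ _).trans ?_
  have h1 : ‖A z * Δ ψ z.2‖ ≤ ‖A z‖ * (d * C) := by
    rw [norm_mul]
    exact mul_le_mul_of_nonneg_left (hψ.norm_laplacian_le _) (norm_nonneg _)
  have h2 : ‖inner ℝ (B z) (gradient ψ z.2)‖ ≤ ‖B z‖ * C :=
    (norm_inner_le_norm _ _).trans
      (mul_le_mul_of_nonneg_left (hψ.norm_gradient_le _) (norm_nonneg _))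
  have h3 : 0 ≤ ‖A z‖ * C := mul_nonneg (norm_nonneg _) hψ.nonneg
  have h4 : 0 ≤ ‖B z‖ * C * d := mul_nonneg (mul_nonneg (norm_nonneg _) hψ.nonneg) d.cast_nonneg
  nlinarith

theorem integrable_spatial_integrand (hA : Integrable A (cylMeasure d T))
    (hB : Integrable B (cylMeasure d T)) {C : ℝ} {ψ : Sp d → ℝ} (hψ : SmoothBounded C ψ) :
    Integrable (fun z => A z * Δ ψ z.2 + inner ℝ (B z) (gradient ψ z.2)) (cylMeasure d T) := by
  refine ((hA.norm.add hB.norm).const_mul ((d + 1) * C)).mono' ?_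
    (ae_of_all _ fun z => norm_spatial_integrand_le hψ z)
  exact (hA.aestronglyMeasurable.mul
      ((continuous_laplacian hψ.1).comp continuous_snd).aestronglyMeasurable).add
    (hB.aestronglyMeasurable.inner
      ((continuous_gradient hψ.1).comp continuous_snd).aestronglyMeasurable)

namespace IsWeakNullSolution

theorem integrableOn_spatialPairing (h : IsWeakNullSolution T V A B) {C : ℝ} {ψ : Sp d → ℝ}
    (hψ : SmoothBounded C ψ) : IntegrableOn (spatialPairing A B ψ) (Ioo 0 T) := by
  have := integrable_spatial_integrand h.integrable_A h.integrable_B hψ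
  rw [cylMeasure_eq_prod] at this
  exact this.integral_prod_left

/-- Tested with `θ(t)ψ(x)`, the equation says that `∫ V ψ` has weak time derivative `spatialPairing
A B ψ`; the initial condition fixes the constant. -/
theorem pairing_test (h : IsWeakNullSolution T V A B) (hT : 0 < T) {ψ : Sp d → ℝ}
    (hψ : IsTest univ ψ) : ∀ᵐ t ∂(volume.restrict (Ioo 0 T)),
      ∫ x, V (t, x) * ψ x = ∫ s in (0)..t, spatialPairing A B ψ s := by
  obtain ⟨C, hC⟩ := hψ.smoothBounded
  have hf := integrable_mul_bounded h.integrable_V hC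
  have hg := integrable_spatial_integrand h.integrable_A h.integrable_B hC
  have hfp := hf
  rw [cylMeasure_eq_prod] at hfp
  refine ae_eq_primitive_of_weak_deriv hT hfp.integral_prod_left
    (h.integrableOn_spatialPairing hC) (fun θ hθ => ?_) (h.init ψ hψ)
  have key := h.weak θ ψ hθ hψ
  have e1 : ∫ z, (V z * (deriv θ z.1 * ψ z.2)
      + θ z.1 * (A z * Δ ψ z.2 + inner ℝ (B z) (gradient ψ z.2))) ∂(cylMeasure d T)
      = ∫ z, ((V z * ψ z.2) * deriv θ z.1
      + (A z * Δ ψ z.2 + inner ℝ (B z) (gradient ψ z.2)) * θ z.1) ∂(cylMeasure d T) :=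
    integral_congr_ae (ae_of_all _ fun z => by ring)
  rw [e1] at key
  refine Eq.trans ?_ key
  have hint1 := integrable_mul_time hf (hθ.1.continuous_deriv (by simp)) hθ.2.1.deriv
  have hint2 := integrable_mul_time hg hθ.1.continuous hθ.2.1
  rw [cylMeasure_eq_prod] at hint1 hint2 ⊢
  rw [integral_add hint1 hint2, integral_prod _ hint1, integral_prod _ hint2,
    ← integral_add (f := fun t => ∫ x, V (t, x) * ψ x * deriv θ t) hint1.integral_prod_left
      hint2.integral_prod_left]
  refine integral_congr_ae (ae_of_all _ fun t => ?_)
  simp only [spatialPairing, integral_mul_const]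

/-- Cosines lack compact support. Since `V`, `A` and `B` are integrable, dominated convergence
carries the identity from cut-off functions to bounded ones. -/
theorem pairing_bounded (h : IsWeakNullSolution T V A B) (hT : 0 < T) {C : ℝ} {ψ : Sp d → ℝ}
    (hψ : SmoothBounded C ψ) : ∀ᵐ t ∂(volume.restrict (Ioo 0 T)),
      ∫ x, V (t, x) * ψ x = ∫ s in (0)..t, spatialPairing A B ψ s := by
  obtain ⟨C', ψs, hts, hbs, hlim⟩ := hψ.exists_test_approx
  have hVi := h.integrable_V
  have hAi := h.integrable_A
  have hBi := h.integrable_B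
  have hABi := hAi.norm.add hBi.norm
  rw [cylMeasure_eq_prod] at hVi hAi hBi hABi
  have hdom : IntegrableOn (fun s => (d + 1) * C' * ∫ x, ‖A (s, x)‖ + ‖B (s, x)‖) (Ioo 0 T) :=
    hABi.integral_prod_left.const_mul _
  have hpt : ∀ᵐ s ∂(volume.restrict (Ioo 0 T)),
      Tendsto (fun n => spatialPairing A B (ψs n) s) atTop (𝓝 (spatialPairing A B ψ s)) := by
    filter_upwards [hABi.prod_right_ae, hAi.prod_right_ae, hBi.prod_right_ae] with s hs hsA hsB
    refine tendsto_integral_of_dominated_convergence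
      (fun x => (d + 1) * C' * (‖A (s, x)‖ + ‖B (s, x)‖)) (fun n => ?_) (hs.const_mul _)
      (fun n => ae_of_all _ fun x => norm_spatial_integrand_le (hbs n) (s, x))
      (ae_of_all _ fun x => ?_)
    · exact (hsA.aestronglyMeasurable.mul
        (continuous_laplacian (hbs n).1).aestronglyMeasurable).add
        (hsB.aestronglyMeasurable.inner (continuous_gradient (hbs n).1).aestronglyMeasurable)
    · refine tendsto_const_nhds.congr' ?_
      filter_upwards [hlim x] with n hn
      rw [hn.gradient_eq, (InnerProductSpace.laplacian_congr_nhds hn).eq_of_nhds]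
  have hbound : ∀ n, ∀ᵐ s ∂(volume.restrict (Ioo 0 T)), ‖spatialPairing A B (ψs n) s‖
      ≤ (d + 1) * C' * ∫ x, ‖A (s, x)‖ + ‖B (s, x)‖ := fun n => by
    filter_upwards [hABi.prod_right_ae] with s hs
    rw [← integral_const_mul]
    exact norm_integral_le_of_norm_le (hs.const_mul _)
      (ae_of_all _ fun x => norm_spatial_integrand_le (hbs n) (s, x))
  -- The exceptional set of times depends on the test function; a sequence of them still leaves a
  -- single null set.
  have hall : ∀ᵐ t ∂(volume.restrict (Ioo 0 T)), ∀ n,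
      ∫ x, V (t, x) * ψs n x = ∫ s in (0)..t, spatialPairing A B (ψs n) s :=
    ae_all_iff.2 fun n => h.pairing_test hT (hts n)
  filter_upwards [hall, hVi.prod_right_ae, ae_restrict_mem measurableSet_Ioo] with t ht htV htT
  have hl : Tendsto (fun n => ∫ x, V (t, x) * ψs n x) atTop (𝓝 (∫ x, V (t, x) * ψ x)) := by
    refine tendsto_integral_of_dominated_convergence (fun x => ‖V (t, x)‖ * C') (fun n => ?_)
      (htV.norm.mul_const _) (fun n => ae_of_all _ fun x => ?_) (ae_of_all _ fun x => ?_)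
    · exact htV.aestronglyMeasurable.mul (hbs n).1.continuous.aestronglyMeasurable
    · rw [norm_mul]
      exact mul_le_mul_of_nonneg_left ((hbs n).norm_le x) (norm_nonneg _)
    · refine tendsto_const_nhds.congr' ?_
      filter_upwards [hlim x] with n hn
      rw [hn.eq_of_nhds]
  have hsub : ∀ {P : ℝ → Prop}, (∀ᵐ s ∂(volume.restrict (Ioo 0 T)), P s) →
      ∀ᵐ s, s ∈ uIoc 0 t → P s := fun {P} hP => by
    rw [ae_restrict_iff' measurableSet_Ioo] at hP
    filter_upwards [hP] with s hs hs'
    rw [uIoc_of_le htT.1.le] at hs'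
    exact hs ⟨hs'.1, hs'.2.trans_lt htT.2⟩
  have hr : Tendsto (fun n => ∫ s in (0)..t, spatialPairing A B (ψs n) s) atTop
      (𝓝 (∫ s in (0)..t, spatialPairing A B ψ s)) := by
    refine intervalIntegral.tendsto_integral_filter_of_dominated_convergence
      (fun s => (d + 1) * C' * ∫ x, ‖A (s, x)‖ + ‖B (s, x)‖) (Eventually.of_forall fun n => ?_)
      (Eventually.of_forall fun n => hsub (hbound n)) ?_ (hsub hpt)
    · rw [uIoc_of_le htT.1.le]
      exact ((h.integrableOn_spatialPairing (hbs n)).mono_set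
        (fun s hs => ⟨hs.1, hs.2.trans_lt htT.2⟩)).aestronglyMeasurable
    · rw [intervalIntegrable_iff_integrableOn_Ioo_of_le htT.1.le]
      exact hdom.mono_set (Ioo_subset_Ioo_right htT.2.le)
  exact tendsto_nhds_unique hl (hr.congr fun n => (ht n).symm)

end IsWeakNullSolution

end FrozenFP

/-! ### The energy density on the Fourier side -/

namespace FrozenFP

open scoped ComplexConjugate

variable {d : ℕ} {T : ℝ} {V A : ℝ × Sp d → ℝ} {B : ℝ × Sp d → Sp d}

/-- The integrand of the `H⁻¹` energy identity on the Fourier side. -/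
noncomputable def energyDensity (η : Sp d) (v a : ℂ) (b : Fin d → ℂ) : ℝ :=
  (1 + ‖η‖ ^ 2)⁻¹ * (2 * (v.re * (-(‖η‖ ^ 2 * a.re) + ∑ j, η j * (b j).im))
    + 2 * (v.im * (-(‖η‖ ^ 2 * a.im) - ∑ j, η j * (b j).re)))

/-- With `w = (1 + ‖η‖²)⁻¹`, the density is `2 w Re(v̄ (-‖η‖² a - i η·b))`. Since `w ‖η‖² = 1 - w`,
its diffusive part is `-2 Re(v̄ a)` plus a remainder carrying the weight `w`. Young's inequality is
applied once to that remainder and once to the drift, whence `2 / δ`; the factor `‖η‖²` from the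
drift is absorbed by `w ‖η‖² ≤ 1`. -/
theorem abs_energyDensity_add_le (η : Sp d) (v a : ℂ) (b : Fin d → ℂ) {δ : ℝ} (hδ : 0 < δ) :
    |energyDensity η v a b + 2 * (conj v * a).re|
      ≤ 2 / δ * ((1 + ‖η‖ ^ 2)⁻¹ * ‖v‖ ^ 2) + δ * (‖a‖ ^ 2 + ∑ j, ‖b j‖ ^ 2) := by
  set N : ℝ := ‖η‖ ^ 2 with hN
  have hN0 : 0 ≤ N := by positivity
  set S₁ : ℝ := ∑ j, η j * (b j).im with hS₁
  set S₂ : ℝ := ∑ j, η j * (b j).re with hS₂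
  set P : ℝ := ∑ j, ‖b j‖ ^ 2 with hP
  have hNs : N = ∑ j, η j ^ 2 := by
    rw [hN, EuclideanSpace.norm_sq_eq]; simp
  have hS : S₁ ^ 2 + S₂ ^ 2 ≤ N * P := by
    have h1 := Finset.sum_mul_sq_le_sq_mul_sq Finset.univ (fun j => η j) (fun j => (b j).im)
    have h2 := Finset.sum_mul_sq_le_sq_mul_sq Finset.univ (fun j => η j) (fun j => (b j).re)
    have h3 : P = (∑ j, (b j).re ^ 2) + ∑ j, (b j).im ^ 2 := by
      rw [hP, ← Finset.sum_add_distrib]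
      refine Finset.sum_congr rfl fun j _ => ?_
      rw [Complex.sq_norm, Complex.normSq_apply]; ring
    rw [h3, hNs, mul_add]
    linarith
  set w : ℝ := (1 + N)⁻¹ with hw
  have hw0 : 0 < w := by positivity
  have hwN : w * N = 1 - w := by rw [hw]; field_simp; ring
  have hw1 : w ≤ 1 := by nlinarith [mul_nonneg hw0.le hN0]
  have hP0 : 0 ≤ P := Finset.sum_nonneg fun _ _ => by positivity
  have hexpr : energyDensity η v a b + 2 * (conj v * a).re
      = w * (2 * (v.re * a.re + v.im * a.im)) + w * (2 * (v.re * S₁ - v.im * S₂)) := by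
    simp only [energyDensity, ← hN, ← hS₁, ← hS₂, ← hw, Complex.mul_re, Complex.conj_re,
      Complex.conj_im]
    linear_combination (-2 * (v.re * a.re + v.im * a.im)) * hwN
  have hv : ‖v‖ ^ 2 = v.re ^ 2 + v.im ^ 2 := by rw [Complex.sq_norm, Complex.normSq_apply]; ring
  have ha : ‖a‖ ^ 2 = a.re ^ 2 + a.im ^ 2 := by rw [Complex.sq_norm, Complex.normSq_apply]; ring
  have young : ∀ x y : ℝ, |2 * (x * y)| ≤ x ^ 2 / δ + δ * y ^ 2 := fun x y => by
    have h1 : x ^ 2 / δ + δ * y ^ 2 - 2 * (x * y) = (x - δ * y) ^ 2 / δ := by field_simp; ring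
    have h2 : x ^ 2 / δ + δ * y ^ 2 + 2 * (x * y) = (x + δ * y) ^ 2 / δ := by field_simp; ring
    have h3 : 0 ≤ (x - δ * y) ^ 2 / δ := by positivity
    have h4 : 0 ≤ (x + δ * y) ^ 2 / δ := by positivity
    rw [abs_le]
    constructor <;> linarith
  have b1 : |2 * (v.re * a.re + v.im * a.im)| ≤ ‖v‖ ^ 2 / δ + δ * ‖a‖ ^ 2 := by
    rw [mul_add, hv, ha, add_div]
    refine (abs_add_le _ _).trans ?_
    linarith [young v.re a.re, young v.im a.im]
  have b2 : |2 * (v.re * S₁ - v.im * S₂)| ≤ ‖v‖ ^ 2 / δ + δ * (N * P) := by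
    rw [mul_sub, hv, add_div]
    refine (abs_sub _ _).trans ?_
    have := mul_le_mul_of_nonneg_left hS hδ.le
    linarith [young v.re S₁, young v.im S₂]
  rw [hexpr]
  refine (abs_add_le _ _).trans ?_
  rw [abs_mul w, abs_mul w, abs_of_pos hw0]
  have c1 := mul_le_mul_of_nonneg_left b1 hw0.le
  have c2 := mul_le_mul_of_nonneg_left b2 hw0.le
  have c3 : w * (δ * ‖a‖ ^ 2) ≤ δ * ‖a‖ ^ 2 := mul_le_of_le_one_left (by positivity) hw1
  have c4 : w * (δ * (N * P)) ≤ δ * P := by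
    have : w * (δ * (N * P)) = (w * N) * (δ * P) := by ring
    rw [this, hwN]
    exact mul_le_of_le_one_left (by positivity) (by linarith)
  have c5 : 2 / δ * (w * ‖v‖ ^ 2) = 2 * (w * (‖v‖ ^ 2 / δ)) := by ring
  rw [c5]
  linarith

/-- The case `δ = 1`; this crude bound supplies the integrability behind Fubini's theorem. -/
theorem abs_energyDensity_le (η : Sp d) (v a : ℂ) (b : Fin d → ℂ) :
    |energyDensity η v a b| ≤ 3 * (‖v‖ ^ 2 + ‖a‖ ^ 2 + ∑ j, ‖b j‖ ^ 2) := by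
  have h1 := abs_energyDensity_add_le η v a b one_pos
  have h2 : |2 * (conj v * a).re| ≤ ‖v‖ ^ 2 + ‖a‖ ^ 2 := by
    have : |(conj v * a).re| ≤ ‖v‖ * ‖a‖ := by
      simpa using Complex.abs_re_le_norm (conj v * a)
    rw [abs_mul, abs_two]
    nlinarith [sq_nonneg (‖v‖ - ‖a‖)]
  have h3 : (1 + ‖η‖ ^ 2)⁻¹ * ‖v‖ ^ 2 ≤ ‖v‖ ^ 2 :=
    mul_le_of_le_one_left (by positivity) (inv_le_one_of_one_le₀ (by nlinarith [norm_nonneg η]))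
  have hP0 : 0 ≤ ∑ j, ‖b j‖ ^ 2 := Finset.sum_nonneg fun _ _ => by positivity
  have h4 : |energyDensity η v a b| ≤ |energyDensity η v a b + 2 * (conj v * a).re|
      + |2 * (conj v * a).re| := by
    simpa using abs_sub (energyDensity η v a b + 2 * (conj v * a).re) (2 * (conj v * a).re)
  nlinarith [sq_nonneg ‖a‖, sq_nonneg ‖v‖]

section RFourier

open scoped FourierTransform

theorem rfourier_eq_integral (f : Sp d → ℝ) (ξ : Sp d) :
    rfourier f ξ = ∫ x, Complex.exp (↑(-2 * Real.pi * inner ℝ x ξ) * Complex.I) * (f x : ℂ) := by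
  rw [rfourier, Real.fourier_eq']
  simp only [smul_eq_mul]

theorem integrable_exp_mul {f : Sp d → ℝ} (hf : Integrable f) (ξ : Sp d) :
    Integrable fun x =>
      Complex.exp (↑(-2 * Real.pi * inner ℝ x ξ) * Complex.I) * (f x : ℂ) :=
  hf.ofReal.bdd_mul (c := 1) (Continuous.aestronglyMeasurable (by fun_prop))
    (ae_of_all _ fun x => (Complex.norm_exp_ofReal_mul_I _).le)

theorem rfourier_re {f : Sp d → ℝ} (hf : Integrable f) (ξ : Sp d) :
    (rfourier f ξ).re = ∫ x, f x * Real.cos (inner ℝ ((2 * Real.pi) • ξ) x + 0) := by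
  rw [rfourier_eq_integral, ← RCLike.re_eq_complex_re, ← integral_re (integrable_exp_mul hf ξ)]
  refine integral_congr_ae (ae_of_all _ fun x => ?_)
  simp only [RCLike.re_eq_complex_re]
  rw [Complex.re_mul_ofReal, Complex.exp_ofReal_mul_I_re, mul_comm, real_inner_smul_left,
    real_inner_comm, ← Real.cos_neg]
  congr 2
  ring

theorem rfourier_im {f : Sp d → ℝ} (hf : Integrable f) (ξ : Sp d) :
    (rfourier f ξ).im = ∫ x, f x * Real.cos (inner ℝ ((2 * Real.pi) • ξ) x + Real.pi / 2) := by
  rw [rfourier_eq_integral, ← RCLike.im_eq_complex_im, ← integral_im (integrable_exp_mul hf ξ)]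
  refine integral_congr_ae (ae_of_all _ fun x => ?_)
  simp only [RCLike.im_eq_complex_im]
  rw [Complex.im_mul_ofReal, Complex.exp_ofReal_mul_I_im, mul_comm, real_inner_smul_left,
    real_inner_comm, Real.cos_add_pi_div_two, ← Real.sin_neg]
  congr 2
  ring

/-- Joint measurability in time and frequency, required for exchanging integrals and null sets. -/
theorem stronglyMeasurable_rfourier {F : ℝ × Sp d → ℝ} (hF : StronglyMeasurable F) :
    StronglyMeasurable fun z : ℝ × Sp d => rfourier (fun x => F (z.1, x)) z.2 := by
  simp only [rfourier_eq_integral]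
  refine StronglyMeasurable.integral_prod_right' (f := fun p : (ℝ × Sp d) × Sp d =>
    Complex.exp (↑(-2 * Real.pi * inner ℝ p.2 p.1.2) * Complex.I) * (F (p.1.1, p.2) : ℂ)) ?_
  refine StronglyMeasurable.mul (Continuous.stronglyMeasurable (by fun_prop)) ?_
  exact Complex.continuous_ofReal.comp_stronglyMeasurable
    (hF.comp_measurable (by fun_prop))

end RFourier

theorem ae_slice {F : ℝ × Sp d → ℝ} (h1 : Integrable F (cylMeasure d T)) (h2 : MemLp F 2 (cylMeasure d T)) :
    ∀ᵐ s ∂(volume.restrict (Ioo 0 T)), Integrable (fun x => F (s, x)) ∧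
      MemLp (fun x => F (s, x)) 2 volume := by
  have h3 := h2.integrable_sq
  rw [cylMeasure_eq_prod] at h1 h3
  filter_upwards [h1.prod_right_ae, h3.prod_right_ae] with s hs1 hs2
  exact ⟨hs1, (memLp_two_iff_integrable_sq hs1.aestronglyMeasurable).2 hs2⟩

/-- Plancherel on almost every time slice, then Tonelli. -/
theorem integrable_norm_sq_rfourier {F : ℝ × Sp d → ℝ} (hF : StronglyMeasurable F)
    (h1 : Integrable F (cylMeasure d T)) (h2 : MemLp F 2 (cylMeasure d T)) :
    Integrable (fun z : ℝ × Sp d => ‖rfourier (fun x => F (z.1, x)) z.2‖ ^ 2)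
      (cylMeasure d T) := by
  have h3 := h2.integrable_sq
  have hsl := ae_slice h1 h2
  have hm : StronglyMeasurable fun z : ℝ × Sp d => ‖rfourier (fun x => F (z.1, x)) z.2‖ ^ 2 :=
    (stronglyMeasurable_rfourier hF).norm.pow 2
  rw [cylMeasure_eq_prod] at h3 ⊢
  rw [integrable_prod_iff hm.aestronglyMeasurable]
  constructor
  · filter_upwards [hsl] with s hs
    exact (memLp_rfourier hs.1 hs.2).integrable_norm_pow (by norm_num)
  · refine h3.integral_prod_left.congr ?_
    filter_upwards [hsl] with s hs
    simp only [norm_pow, norm_norm]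
    exact (integral_norm_sq_rfourier hs.1 hs.2).symm

end FrozenFP

/-! ### The energy identity at a fixed frequency -/

namespace FrozenFP

open scoped ComplexConjugate

variable {d : ℕ} {T : ℝ} {V A : ℝ × Sp d → ℝ} {B : ℝ × Sp d → Sp d}

theorem integrable_coord {μ : Measure (Sp d)} {F : Sp d → Sp d} (hF : Integrable F μ) (j : Fin d) :
    Integrable (fun x => F x j) μ :=
  (EuclideanSpace.proj (𝕜 := ℝ) j).integrable_comp hF

/-- Differentiating a cosine advances its phase by `π / 2`, so the equation tested with
phase-shifted cosines closes on the Fourier coefficients of `A` and `B`. -/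
theorem spatialPairing_cos {s : ℝ} (hA : Integrable fun x => A (s, x))
    (hB : Integrable fun x => B (s, x)) (η : Sp d) (θ : ℝ) :
    spatialPairing A B (fun y => Real.cos (inner ℝ η y + θ)) s
      = -(‖η‖ ^ 2 * ∫ x, A (s, x) * Real.cos (inner ℝ η x + θ))
        + ∑ j, η j * ∫ x, B (s, x) j * Real.cos (inner ℝ η x + (θ + Real.pi / 2)) := by
  have hbd : ∀ {f : Sp d → ℝ} (θ' : ℝ), Integrable f →
      Integrable fun x => f x * Real.cos (inner ℝ η x + θ') := fun θ' hf =>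
    hf.mul_bdd (c := 1) (Continuous.aestronglyMeasurable (by fun_prop))
      (ae_of_all _ fun x => Real.abs_cos_le_one _)
  have hBj := fun j => ((hbd (θ + Real.pi / 2) (integrable_coord hB j)).const_mul (η j))
  have hA' : Integrable fun x => -(‖η‖ ^ 2 * (A (s, x) * Real.cos (inner ℝ η x + θ))) :=
    ((hbd θ hA).const_mul _).neg
  rw [← integral_const_mul, ← integral_neg]
  simp only [← integral_const_mul]
  rw [← integral_finsetSum _ fun j _ => hBj j,
    ← integral_add hA' (integrable_finsetSum _ fun j _ => hBj j)]
  refine integral_congr_ae (ae_of_all _ fun x => ?_)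
  simp only [laplacian_cos_inner, gradient_cos_inner]
  rw [← add_assoc, Real.cos_add_pi_div_two, inner_smul_right, PiLp.inner_apply (B (s, x)) η, Finset.mul_sum]
  congr 1
  · ring
  · refine Finset.sum_congr rfl fun j _ => ?_
    simp only [RCLike.inner_apply, conj_trivial]
    ring

/-- The integrand of the energy identity for the triple `(V, A, B)`, at `(s, ξ)`. -/
noncomputable def energyAt (V A : ℝ × Sp d → ℝ) (B : ℝ × Sp d → Sp d) (z : ℝ × Sp d) : ℝ :=
  energyDensity ((2 * Real.pi) • z.2) (rfourier (fun x => V (z.1, x)) z.2)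
    (rfourier (fun x => A (z.1, x)) z.2) (fun j => rfourier (fun x => B (z.1, x) j) z.2)

theorem energyAt_eq {s : ℝ} (hV : Integrable fun x => V (s, x)) (hA : Integrable fun x => A (s, x))
    (hB : Integrable fun x => B (s, x)) (ξ : Sp d) :
    energyAt V A B (s, ξ) = (1 + ‖(2 * Real.pi) • ξ‖ ^ 2)⁻¹ *
      (2 * ((∫ x, V (s, x) * Real.cos (inner ℝ ((2 * Real.pi) • ξ) x + 0))
          * spatialPairing A B (fun y => Real.cos (inner ℝ ((2 * Real.pi) • ξ) y + 0)) s)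
      + 2 * ((∫ x, V (s, x) * Real.cos (inner ℝ ((2 * Real.pi) • ξ) x + Real.pi / 2))
          * spatialPairing A B
            (fun y => Real.cos (inner ℝ ((2 * Real.pi) • ξ) y + Real.pi / 2)) s)) := by
  rw [spatialPairing_cos hA hB, spatialPairing_cos hA hB]
  have h2 : ∀ x : Sp d, Real.cos (inner ℝ ((2 * Real.pi) • ξ) x + (Real.pi / 2 + Real.pi / 2))
      = - Real.cos (inner ℝ ((2 * Real.pi) • ξ) x + 0) := fun x => by
    rw [add_halves, Real.cos_add_pi, add_zero]
  simp only [h2, mul_neg, integral_neg, zero_add, Finset.sum_neg_distrib]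
  simp only [energyAt, energyDensity, rfourier_re hV, rfourier_im hV, rfourier_re hA,
    rfourier_im hA, rfourier_re (integrable_coord hB _), rfourier_im (integrable_coord hB _)]
  ring

namespace IsWeakNullSolution

/-- The real and imaginary parts of the Fourier coefficient of `V` are primitives of the pairings at
phases `0` and `π / 2`; their squares are differentiated and added. -/
theorem energy_identity (h : IsWeakNullSolution T V A B) (hT : 0 < T) (ξ : Sp d) :
    ∀ᵐ t ∂(volume.restrict (Ioo 0 T)),
      (1 + ‖(2 * Real.pi) • ξ‖ ^ 2)⁻¹ * ‖rfourier (fun x => V (t, x)) ξ‖ ^ 2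
        = ∫ s in Ioo 0 t, energyAt V A B (s, ξ) := by
  have hVi := h.integrable_V
  have hAi := h.integrable_A
  have hBi := h.integrable_B
  rw [cylMeasure_eq_prod] at hVi hAi hBi
  set η : Sp d := (2 * Real.pi) • ξ with hη
  set m : ℝ → ℝ → ℝ := fun θ t => ∫ x, V (t, x) * Real.cos (inner ℝ η x + θ) with hm
  set k : ℝ → ℝ → ℝ := fun θ => spatialPairing A B (fun y => Real.cos (inner ℝ η y + θ)) with hk
  have hki : ∀ θ, IntegrableOn (k θ) (Ioo 0 T) := fun θ =>
    h.integrableOn_spatialPairing (smoothBounded_cos_inner η θ)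
  have hmk : ∀ θ, ∀ᵐ t ∂(volume.restrict (Ioo 0 T)), m θ t = ∫ s in (0)..t, k θ s := fun θ =>
    h.pairing_bounded hT (smoothBounded_cos_inner η θ)
  have hmki := fun θ => integrableOn_mul_of_ae_eq_primitive hT (hki θ) (hmk θ)
  have hen : ∀ᵐ s ∂(volume.restrict (Ioo 0 T)), energyAt V A B (s, ξ) = (1 + ‖η‖ ^ 2)⁻¹ *
      (2 * (m 0 s * k 0 s) + 2 * (m (Real.pi / 2) s * k (Real.pi / 2) s)) := by
    filter_upwards [hVi.prod_right_ae, hAi.prod_right_ae, hBi.prod_right_ae] with s h1 h2 h3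
    exact energyAt_eq h1 h2 h3 ξ
  filter_upwards [sq_ae_eq_primitive (hki 0) (hmk 0),
    sq_ae_eq_primitive (hki (Real.pi / 2)) (hmk (Real.pi / 2)), hVi.prod_right_ae,
    ae_restrict_mem measurableSet_Ioo] with t h1 h2 h3 htT
  have hsub : Ioo 0 t ⊆ Ioo 0 T := Ioo_subset_Ioo_right htT.2.le
  rw [integral_congr_ae (ae_restrict_of_ae_restrict_of_subset hsub hen), integral_const_mul,
    integral_add (((hmki 0).mono_set hsub).const_mul 2)
      (((hmki (Real.pi / 2)).mono_set hsub).const_mul 2), ← h1, ← h2, Complex.sq_norm,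
      Complex.normSq_apply, rfourier_re h3, rfourier_im h3]
  simp only [hm, hη]
  ring

end IsWeakNullSolution

theorem stronglyMeasurable_energyAt (hV : StronglyMeasurable V) (hA : StronglyMeasurable A)
    (hB : StronglyMeasurable B) : StronglyMeasurable (energyAt V A B) := by
  have h1 := stronglyMeasurable_rfourier hV
  have h2 := stronglyMeasurable_rfourier hA
  have h3 : ∀ j, StronglyMeasurable fun z : ℝ × Sp d =>
      rfourier (fun x => B (z.1, x) j) z.2 := fun j =>
    stronglyMeasurable_rfourier (F := fun z => B z j)
      ((EuclideanSpace.proj (𝕜 := ℝ) j).continuous.comp_stronglyMeasurable hB)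
  have hre := fun {f : ℝ × Sp d → ℂ} (hf : StronglyMeasurable f) =>
    Complex.continuous_re.comp_stronglyMeasurable hf
  have him := fun {f : ℝ × Sp d → ℂ} (hf : StronglyMeasurable f) =>
    Complex.continuous_im.comp_stronglyMeasurable hf
  have hη : Continuous fun z : ℝ × Sp d => (2 * Real.pi) • z.2 := by fun_prop
  have hN : StronglyMeasurable fun z : ℝ × Sp d => ‖(2 * Real.pi) • z.2‖ ^ 2 :=
    (hη.norm.pow 2).stronglyMeasurable
  have hw : StronglyMeasurable fun z : ℝ × Sp d => (1 + ‖(2 * Real.pi) • z.2‖ ^ 2)⁻¹ :=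
    (Continuous.inv₀ (by fun_prop) fun z => by positivity).stronglyMeasurable
  have hηj : ∀ j, StronglyMeasurable fun z : ℝ × Sp d => ((2 * Real.pi) • z.2) j := fun j =>
    ((EuclideanSpace.proj (𝕜 := ℝ) j).continuous.comp hη).stronglyMeasurable
  refine hw.mul (StronglyMeasurable.add ?_ ?_)
  · refine ((hre h1).mul ((hN.mul (hre h2)).neg.add ?_)).const_mul 2
    exact Finset.stronglyMeasurable_fun_sum _ fun j _ => (hηj j).mul (him (h3 j))
  · refine ((him h1).mul ((hN.mul (him h2)).neg.sub ?_)).const_mul 2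
    exact Finset.stronglyMeasurable_fun_sum _ fun j _ => (hηj j).mul (hre (h3 j))

end FrozenFP

/-! ### The `H⁻¹` energy estimate -/

namespace FrozenFP

open scoped ComplexConjugate

variable {d : ℕ} {T : ℝ} {V A : ℝ × Sp d → ℝ} {B : ℝ × Sp d → Sp d}

/-- The identity holds for every frequency outside a null set of times depending on that frequency.
Fubini for null sets exchanges the quantifiers, provided the set where it holds is measurable. -/
theorem ae_ae_of_forall_ae_energy (hT : 0 < T) (h : IsWeakNullSolution T V A B)
    (hV : StronglyMeasurable V) (hA : StronglyMeasurable A) (hB : StronglyMeasurable B) :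
    ∀ᵐ t ∂(volume.restrict (Ioo 0 T)), ∀ᵐ ξ : Sp d,
      (1 + ‖(2 * Real.pi) • ξ‖ ^ 2)⁻¹ * ‖rfourier (fun x => V (t, x)) ξ‖ ^ 2
        = ∫ s in Ioo 0 t, energyAt V A B (s, ξ) := by
  refine (Measure.ae_ae_comm ?_).2 (ae_of_all _ fun ξ => h.energy_identity hT ξ)
  refine measurableSet_eq_fun ?_ ?_
  · refine StronglyMeasurable.measurable (StronglyMeasurable.mul ?_ ?_)
    · exact (Continuous.inv₀ (by fun_prop) fun z => by positivity).stronglyMeasurable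
    · exact (stronglyMeasurable_rfourier hV).norm.pow 2
  -- The variable endpoint `t` is moved into an indicator, so that the time integral becomes a
  -- parametric integral over a fixed space.
  · have hS : MeasurableSet {p : (ℝ × Sp d) × ℝ | p.2 ∈ Ioo 0 p.1.1} :=
      (measurableSet_lt measurable_const measurable_snd : MeasurableSet
        {p : (ℝ × Sp d) × ℝ | 0 < p.2}).inter
        (measurableSet_lt measurable_snd measurable_fst.fst)
    have hm := (((stronglyMeasurable_energyAt hV hA hB).comp_measurable
      (g := fun p : (ℝ × Sp d) × ℝ => (p.2, p.1.2)) (by fun_prop)).indicator hS).integral_prod_right'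
      (ν := volume)
    convert! hm.measurable using 2 with p
    rw [← integral_indicator measurableSet_Ioo]
    rfl

/-- Uniqueness for the parabolic problem `∂ₜV = ΔA - div B` with zero initial datum, where `A` is
comparable with `V` and `B` is dominated by `V`. -/
theorem IsWeakNullSolution.ae_eq_zero (h : IsWeakNullSolution T V A B) (hT : 0 < T)
    (hV : StronglyMeasurable V) (hA : StronglyMeasurable A) (hB : StronglyMeasurable B)
    (hV2 : MemLp V 2 (cylMeasure d T)) {α C : ℝ} (hα : 0 < α)
    (hAle : ∀ z, ‖A z‖ ≤ C * ‖V z‖) (hBle : ∀ z, ‖B z‖ ≤ C * ‖V z‖)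
    (hco : ∀ z, α * V z ^ 2 ≤ V z * A z) :
    ∀ᵐ z ∂(cylMeasure d T), V z = 0 := by
  have hA2 : MemLp A 2 (cylMeasure d T) :=
    hV2.of_le_mul hA.aestronglyMeasurable (ae_of_all _ hAle)
  have hBjm : ∀ j, StronglyMeasurable fun z : ℝ × Sp d => B z j := fun j =>
    (EuclideanSpace.proj (𝕜 := ℝ) j).continuous.comp_stronglyMeasurable hB
  have hBj2 : ∀ j, MemLp (fun z => B z j) 2 (cylMeasure d T) := fun j =>
    hV2.of_le_mul (hBjm j).aestronglyMeasurable
      (ae_of_all _ fun z => (PiLp.norm_apply_le (B z) j).trans (hBle z))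
  have hBj1 : ∀ j, Integrable (fun z => B z j) (cylMeasure d T) := fun j =>
    (EuclideanSpace.proj (𝕜 := ℝ) j).integrable_comp h.integrable_B
  -- Chosen so that `δ C² ≤ α`: then `δ (A² + |B|²) ≤ 2 α V² ≤ 2 V A`, and the dissipation absorbs
  -- the Young remainder.
  set δ : ℝ := α / (C ^ 2 + 1) with hδ
  have hδ0 : 0 < δ := by positivity
  -- The squared `H⁻¹` norm of `V(t)`.
  set G : ℝ → ℝ := fun t => ∫ ξ : Sp d, (1 + ‖(2 * Real.pi) • ξ‖ ^ 2)⁻¹ *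
    ‖rfourier (fun x => V (t, x)) ξ‖ ^ 2 with hG
  have hw0 : ∀ ξ : Sp d, 0 < (1 + ‖(2 * Real.pi) • ξ‖ ^ 2)⁻¹ := fun ξ => by positivity
  have hw1 : ∀ ξ : Sp d, (1 + ‖(2 * Real.pi) • ξ‖ ^ 2)⁻¹ ≤ 1 := fun ξ =>
    inv_le_one_of_one_le₀ (by nlinarith [norm_nonneg ((2 * Real.pi) • ξ)])
  have hwc : Continuous fun ξ : Sp d => (1 + ‖(2 * Real.pi) • ξ‖ ^ 2)⁻¹ :=
    Continuous.inv₀ (by fun_prop) fun z => by positivity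
  have hFV := integrable_norm_sq_rfourier hV h.integrable_V hV2
  have hFA := integrable_norm_sq_rfourier hA h.integrable_A hA2
  have hFB := fun j => integrable_norm_sq_rfourier (hBjm j) (hBj1 j) (hBj2 j)
  have hEint : Integrable (energyAt V A B) (cylMeasure d T) := by
    refine (((hFV.add hFA).add (integrable_finsetSum Finset.univ fun j _ => hFB j)).const_mul 3).mono'
      (stronglyMeasurable_energyAt hV hA hB).aestronglyMeasurable (ae_of_all _ fun z => ?_)
    exact abs_energyDensity_le _ _ _ _
  have hwV : Integrable (fun z : ℝ × Sp d => (1 + ‖(2 * Real.pi) • z.2‖ ^ 2)⁻¹ *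
      ‖rfourier (fun x => V (z.1, x)) z.2‖ ^ 2) (cylMeasure d T) :=
    hFV.bdd_mul (c := 1) (hwc.comp continuous_snd).aestronglyMeasurable
      (ae_of_all _ fun z => by rw [Real.norm_of_nonneg (hw0 _).le]; exact hw1 _)
  rw [cylMeasure_eq_prod] at hEint hwV
  have hslA := ae_slice h.integrable_A hA2
  have hslV := ae_slice h.integrable_V hV2
  have hslB := ae_all_iff.2 fun j => ae_slice (hBj1 j) (hBj2 j)
  -- dissipation estimate at almost every time
  have hstep : ∀ᵐ s ∂(volume.restrict (Ioo 0 T)),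
      ∫ ξ, energyAt V A B (s, ξ) ≤ 2 / δ * G s := by
    filter_upwards [hslA, hslV, hslB, hEint.prod_right_ae, hwV.prod_right_ae]
      with s hsA hsV hsB hsE hsw
    set v := rfourier (fun x => V (s, x)) with hv
    set a := rfourier (fun x => A (s, x)) with ha
    set b : Fin d → Sp d → ℂ := fun j => rfourier (fun x => B (s, x) j) with hb
    have hv2 := memLp_rfourier hsV.1 hsV.2
    have ha2 := memLp_rfourier hsA.1 hsA.2
    have hva : Integrable fun ξ => (conj (v ξ) * a ξ).re :=
      (hv2.star.integrable_mul ha2).re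
    have haI : Integrable fun ξ => ‖a ξ‖ ^ 2 := ha2.integrable_norm_pow (by norm_num)
    have hbI : ∀ j, Integrable fun ξ => ‖b j ξ‖ ^ 2 := fun j =>
      (memLp_rfourier (hsB j).1 (hsB j).2).integrable_norm_pow (by norm_num)
    have hbS : Integrable fun ξ => ∑ j, ‖b j ξ‖ ^ 2 := integrable_finsetSum _ fun j _ => hbI j
    have hI1 : Integrable fun ξ => -2 * (conj (v ξ) * a ξ).re := hva.const_mul _
    have hI2 : Integrable fun ξ => 2 / δ * ((1 + ‖(2 * Real.pi) • ξ‖ ^ 2)⁻¹ * ‖v ξ‖ ^ 2) :=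
      hsw.const_mul _
    have hI3 : Integrable fun ξ => δ * (‖a ξ‖ ^ 2 + ∑ j, ‖b j ξ‖ ^ 2) :=
      (haI.add hbS).const_mul _
    have hI12 : Integrable fun ξ => -2 * (conj (v ξ) * a ξ).re
        + 2 / δ * ((1 + ‖(2 * Real.pi) • ξ‖ ^ 2)⁻¹ * ‖v ξ‖ ^ 2) := hI1.add hI2
    have hle : ∫ ξ, energyAt V A B (s, ξ) ≤ ∫ ξ, (-2 * (conj (v ξ) * a ξ).re
        + 2 / δ * ((1 + ‖(2 * Real.pi) • ξ‖ ^ 2)⁻¹ * ‖v ξ‖ ^ 2)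
        + δ * (‖a ξ‖ ^ 2 + ∑ j, ‖b j ξ‖ ^ 2)) := by
      refine integral_mono hsE (hI12.add hI3) fun ξ => ?_
      have := (abs_le.1 (abs_energyDensity_add_le ((2 * Real.pi) • ξ) (v ξ) (a ξ)
        (fun j => b j ξ) hδ0)).2
      change energyDensity _ (v ξ) (a ξ) (fun j => b j ξ) ≤ _
      linarith
    rw [integral_add hI12 hI3, integral_add hI1 hI2, integral_const_mul, integral_const_mul,
      integral_const_mul, integral_add haI hbS, integral_finsetSum _ fun j _ => hbI j,
      integral_re_conj_rfourier_mul hsV.1 hsV.2 hsA.1 hsA.2,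
      integral_norm_sq_rfourier hsA.1 hsA.2] at hle
    simp only [hb, integral_norm_sq_rfourier (hsB _).1 (hsB _).2] at hle
    rw [← integral_finsetSum _ fun j _ => (hsB j).2.integrable_sq,
      ← integral_add hsA.2.integrable_sq (integrable_finsetSum _ fun j _ => (hsB j).2.integrable_sq)]
      at hle
    have hVA : Integrable fun x => V (s, x) * A (s, x) := hsV.2.integrable_mul hsA.2
    have hdiss : δ * ∫ x, (A (s, x) ^ 2 + ∑ j, B (s, x) j ^ 2) ≤ 2 * ∫ x, V (s, x) * A (s, x) := by
      rw [← integral_const_mul, ← integral_const_mul]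
      refine integral_mono ((hsA.2.integrable_sq.add
        (integrable_finsetSum _ fun j _ => (hsB j).2.integrable_sq)).const_mul _)
        (hVA.const_mul _) fun x => ?_
      have e1 : A (s, x) ^ 2 ≤ C ^ 2 * V (s, x) ^ 2 := by
        have := pow_le_pow_left₀ (norm_nonneg _) (hAle (s, x)) 2
        simpa [mul_pow] using this
      have e2 : ∑ j, B (s, x) j ^ 2 ≤ C ^ 2 * V (s, x) ^ 2 := by
        have := pow_le_pow_left₀ (norm_nonneg _) (hBle (s, x)) 2
        rw [EuclideanSpace.norm_sq_eq] at this
        simpa [mul_pow] using this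
      have e3 : δ * (C ^ 2 * V (s, x) ^ 2) ≤ α * V (s, x) ^ 2 := by
        rw [← mul_assoc]
        refine mul_le_mul_of_nonneg_right ?_ (sq_nonneg _)
        rw [hδ, div_mul_eq_mul_div, div_le_iff₀ (by positivity)]
        nlinarith
      have e4 := hco (s, x)
      have e5 := mul_le_mul_of_nonneg_left (add_le_add e1 e2) hδ0.le
      dsimp only
      linarith
    have hGs : G s = ∫ ξ, (1 + ‖(2 * Real.pi) • ξ‖ ^ 2)⁻¹ * ‖v ξ‖ ^ 2 := rfl
    rw [hGs]
    linarith
  have hGint : IntegrableOn G (Ioo 0 T) := hwV.integral_prod_left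
  have hG0 : ∀ t, 0 ≤ G t := fun t =>
    integral_nonneg fun ξ => mul_nonneg (hw0 ξ).le (sq_nonneg _)
  have hGle : ∀ᵐ t ∂(volume.restrict (Ioo 0 T)), G t ≤ 2 / δ * ∫ s in Ioo 0 t, G s := by
    filter_upwards [ae_ae_of_forall_ae_energy hT h hV hA hB, ae_restrict_mem measurableSet_Ioo]
      with t ht htT
    have hsub : Ioo 0 t ⊆ Ioo 0 T := Ioo_subset_Ioo_right htT.2.le
    have hE' : Integrable (energyAt V A B) ((volume.restrict (Ioo 0 t)).prod volume) :=
      hEint.mono_measure (Measure.prod_mono (Measure.restrict_mono hsub le_rfl) le_rfl)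
    calc G t = ∫ ξ, ∫ s in Ioo 0 t, energyAt V A B (s, ξ) := integral_congr_ae ht
      _ = ∫ s in Ioo 0 t, ∫ ξ, energyAt V A B (s, ξ) :=
        (integral_integral_swap (f := fun s ξ => energyAt V A B (s, ξ)) hE').symm
      _ ≤ ∫ s in Ioo 0 t, 2 / δ * G s :=
        integral_mono_ae hE'.integral_prod_left ((hGint.mono_set hsub).const_mul _)
          (ae_restrict_of_ae_restrict_of_subset hsub hstep)
      _ = _ := integral_const_mul _ _
  have hGz := ae_eq_zero_of_le_integral hGint hG0 hGle
  rw [cylMeasure_eq_prod]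
  refine (Measure.ae_prod_iff_ae_ae (measurableSet_eq_fun hV.measurable measurable_const)).2 ?_
  filter_upwards [hGz, hslV, hwV.prod_right_ae] with t ht hsV hsw
  -- The weight is positive, so the Fourier transform of `V(t)` vanishes almost everywhere, and
  -- Plancherel gives `V(t) = 0`.
  have h1 := (integral_eq_zero_iff_of_nonneg
    (fun ξ => mul_nonneg (hw0 ξ).le (sq_nonneg _)) hsw).1 ht
  have h2 : ∫ x, V (t, x) ^ 2 = 0 := by
    rw [← integral_norm_sq_rfourier hsV.1 hsV.2]
    refine integral_eq_zero_of_ae ?_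
    filter_upwards [h1] with ξ hξ
    exact (mul_eq_zero.1 hξ).resolve_left (hw0 ξ).ne'
  have h3 := (integral_eq_zero_iff_of_nonneg (fun x => sq_nonneg (V (t, x)))
    hsV.2.integrable_sq).1 h2
  filter_upwards [h3] with x hx
  exact pow_eq_zero_iff (two_ne_zero) |>.1 hx

end FrozenFP

/-! ### Bounds on the frozen coefficients -/

namespace FrozenFP

variable {d : ℕ} {T : ℝ}

theorem _root_.MeasureTheory.MemLp.exists_ae_norm_le {X F : Type*} [MeasurableSpace X]
    [NormedAddCommGroup F] {μ : Measure X} {f : X → F} (hf : MemLp f ∞ μ) :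
    ∃ M, 0 ≤ M ∧ ∀ᵐ x ∂μ, ‖f x‖ ≤ M := by
  refine ⟨(eLpNorm f ∞ μ).toReal, ENNReal.toReal_nonneg, ?_⟩
  filter_upwards [ae_le_eLpNormEssSup (f := f) (μ := μ)] with x hx
  rw [← eLpNorm_exponent_top] at hx
  simpa using ENNReal.toReal_mono hf.2.ne hx

/-- The mean value theorem on the interval between `0` and `r`. Both ellipticity bounds on `β(u)/u`
are read off from bounds on `β'`. -/
theorem exists_diffusivity_eq_deriv {β : ℝ → ℝ} (hβ : ContDiff ℝ 1 β) (h0 : β 0 = 0) (r : ℝ) :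
    ∃ c, |c| ≤ |r| ∧ diffusivity β r = deriv β c := by
  have hd : Differentiable ℝ β := hβ.differentiable (by norm_num)
  rcases lt_trichotomy r 0 with hr | rfl | hr
  · obtain ⟨c, hc, h⟩ := exists_deriv_eq_slope β hr hd.continuous.continuousOn
      hd.differentiableOn
    refine ⟨c, ?_, ?_⟩
    · rw [abs_of_neg hc.2, abs_of_neg hr]; linarith [hc.1]
    · rw [h, diffusivity, if_neg hr.ne, h0]; simp [neg_div_neg_eq]
  · exact ⟨0, le_rfl, by simp [diffusivity]⟩
  · obtain ⟨c, hc, h⟩ := exists_deriv_eq_slope β hr hd.continuous.continuousOn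
      hd.differentiableOn
    refine ⟨c, ?_, ?_⟩
    · rw [abs_of_pos hc.1, abs_of_pos hr]; exact hc.2.le
    · rw [h, diffusivity, if_neg hr.ne', h0]; simp

theorem exists_diffusivity_le {β : ℝ → ℝ} (hβ : ContDiff ℝ 1 β) (h0 : β 0 = 0) (M : ℝ) :
    ∃ C, ∀ r, |r| ≤ M → ‖diffusivity β r‖ ≤ C := by
  obtain ⟨C, hC⟩ := (isCompact_Icc (a := -M) (b := M)).exists_bound_of_continuousOn
    (hβ.continuous_deriv le_rfl).continuousOn
  refine ⟨C, fun r hr => ?_⟩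
  obtain ⟨c, hc, h⟩ := exists_diffusivity_eq_deriv hβ h0 r
  rw [h]
  exact hC c (abs_le.1 (hc.trans hr))

/-- A kernel that is integrable near the origin and bounded away from it acts boundedly from
`L¹ ∩ L^∞` to `L^∞` by convolution. -/
theorem exists_norm_convolution_le {K : Sp d → Sp d}
    (hK1 : IntegrableOn K (Metric.closedBall 0 1) volume)
    (hK2 : MemLp K ∞ (volume.restrict (Metric.closedBall 0 1)ᶜ)) (M : ℝ) :
    ∃ C, ∀ w : Sp d → ℝ, Integrable w → (∀ᵐ x, ‖w x‖ ≤ M) → ∫ x, ‖w x‖ ≤ 1 →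
      ∀ x, ‖convolution w K (ContinuousLinearMap.lsmul ℝ ℝ) volume x‖ ≤ C := by
  obtain ⟨κ, hκ0, hκ⟩ := hK2.exists_ae_norm_le
  rw [ae_restrict_iff' Metric.isClosed_closedBall.measurableSet.compl] at hκ
  have hKi : Integrable ((Metric.closedBall 0 1).indicator K) :=
    hK1.integrable_indicator Metric.isClosed_closedBall.measurableSet
  -- Near the origin `w` is bounded by `M` and `K` is integrated; away from it `K` is bounded by `κ`
  -- and `w` has mass at most one.
  refine ⟨M * (∫ x, ‖(Metric.closedBall 0 1).indicator K x‖) + κ, fun w hw hwM hw1 x => ?_⟩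
  have hKx : Integrable fun t => ‖(Metric.closedBall 0 1).indicator K (x - t)‖ :=
    (hKi.comp_sub_left x).norm
  have hκx := (quasiMeasurePreserving_sub_left (volume : Measure (Sp d)) x).ae hκ
  calc ‖convolution w K (ContinuousLinearMap.lsmul ℝ ℝ) volume x‖
      ≤ ∫ t, (M * ‖(Metric.closedBall 0 1).indicator K (x - t)‖ + κ * ‖w t‖) := by
        refine norm_integral_le_of_norm_le ((hKx.const_mul M).add (hw.norm.const_mul κ)) ?_
        filter_upwards [hwM, hκx] with t ht hκt
        rw [ContinuousLinearMap.lsmul_apply, norm_smul]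
        by_cases hmem : x - t ∈ Metric.closedBall (0 : Sp d) 1
        · rw [indicator_of_mem hmem]
          exact le_add_of_le_of_nonneg (mul_le_mul_of_nonneg_right ht (norm_nonneg _))
            (by positivity)
        · rw [indicator_of_notMem hmem, norm_zero, mul_zero, zero_add, mul_comm]
          exact mul_le_mul_of_nonneg_right (hκt hmem) (norm_nonneg _)
    _ = M * (∫ t, ‖(Metric.closedBall 0 1).indicator K (x - t)‖) + κ * ∫ t, ‖w t‖ := by
        rw [integral_add (hKx.const_mul M) (hw.norm.const_mul κ), integral_const_mul,
          integral_const_mul]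
    _ ≤ _ := by
        rw [integral_sub_left_eq_self
          (fun t => ‖(Metric.closedBall 0 1).indicator K t‖) volume x]
        have := mul_le_mul_of_nonneg_left hw1 hκ0
        linarith

/-- `b` is bounded on the compact range `[-M, M]` of `u`, `D` is bounded, and the convolution is
bounded uniformly in time because every `u(t)` has mass one. -/
theorem exists_ae_norm_drift_le {β b : ℝ → ℝ} {D K : Sp d → Sp d} (hyp : Hypotheses d β b D K)
    {u : ℝ → Sp d → ℝ} (hu : ∀ t, 0 ≤ t → IsProbDensity (u t)) {M : ℝ}
    (hM : ∀ᵐ z ∂(cylMeasure d T), ‖u z.1 z.2‖ ≤ M) :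
    ∃ C, ∀ᵐ z ∂(cylMeasure d T), ‖drift b D K (u z.1) z.2‖ ≤ C := by
  obtain ⟨C₁, hC₁⟩ := exists_norm_convolution_le hyp.K_near hyp.K_far_bounded M
  obtain ⟨C₂, hC₂0, hC₂⟩ := hyp.D_bounded.exists_ae_norm_le
  obtain ⟨C₃, hC₃⟩ := (isCompact_Icc (a := -M) (b := M)).exists_bound_of_continuousOn
    hyp.b_contDiff.continuous.continuousOn
  refine ⟨C₃ * C₂ + C₁, ?_⟩
  rw [cylMeasure_eq_prod] at hM ⊢
  have hconv : ∀ᵐ t ∂(volume.restrict (Ioo 0 T)), ∀ x,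
      ‖convolution (u t) K (ContinuousLinearMap.lsmul ℝ ℝ) volume x‖ ≤ C₁ := by
    filter_upwards [Measure.ae_ae_of_ae_prod hM, ae_restrict_mem measurableSet_Ioo] with t ht htT
    obtain ⟨h1, h2, h3⟩ := hu t htT.1.le
    refine hC₁ (u t) h1 ht (le_of_eq ?_)
    rw [← h3]
    refine integral_congr_ae ?_
    filter_upwards [h2] with x hx
    exact Real.norm_of_nonneg hx
  filter_upwards [hM, Measure.quasiMeasurePreserving_fst.ae hconv,
    Measure.quasiMeasurePreserving_snd.ae hC₂] with z h1 h2 h3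
  refine (norm_add_le _ _).trans (add_le_add ?_ (h2 z.2))
  rw [norm_smul]
  have h4 := hC₃ _ (abs_le.1 h1)
  exact mul_le_mul h4 h3 (norm_nonneg _) ((norm_nonneg _).trans h4)

theorem gradient_const_mul {ψ : Sp d → ℝ} (hψ : ContDiff ℝ ∞ ψ) (c : ℝ) (x : Sp d) :
    gradient (fun y => c * ψ y) x = c • gradient ψ x := by
  have hd : DifferentiableAt ℝ ψ x := hψ.differentiable (by simp) x
  rw [gradient, gradient, fderiv_const_mul hd, map_smulₛₗ]
  simp

theorem laplacian_const_mul {ψ : Sp d → ℝ} (hψ : ContDiff ℝ ∞ ψ) (c : ℝ) (x : Sp d) :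
    Δ (fun y => c * ψ y) x = c * Δ ψ x :=
  InnerProductSpace.laplacian_smul c (contDiff_infty.1 hψ 2).contDiffAt

theorem isTest_mul {θ : ℝ → ℝ} {ψ : Sp d → ℝ} (hθ : IsTest (Ioo 0 T) θ) (hψ : IsTest univ ψ) :
    IsTest (cyl d T) (fun z : ℝ × Sp d => θ z.1 * ψ z.2) := by
  have hsub : tsupport (fun z : ℝ × Sp d => θ z.1 * ψ z.2) ⊆ tsupport θ ×ˢ tsupport ψ := by
    refine closure_minimal (fun z hz => ?_) ((isClosed_tsupport _).prod (isClosed_tsupport _))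
    exact ⟨subset_tsupport _ (left_ne_zero_of_mul hz), subset_tsupport _ (right_ne_zero_of_mul hz)⟩
  refine ⟨(hθ.1.comp contDiff_fst).mul (hψ.1.comp contDiff_snd), ?_, ?_⟩
  · exact (hθ.2.1.isCompact.prod hψ.2.1.isCompact).of_isClosed_subset (isClosed_tsupport _) hsub
  · exact hsub.trans fun z hz => ⟨hθ.2.2 hz.1, mem_univ _⟩

theorem _root_.MeasureTheory.MemLp.memLp_two_of_one_of_top {X : Type*} [MeasurableSpace X]
    {μ : Measure X} {f : X → ℝ} (h1 : MemLp f 1 μ) (h2 : MemLp f ∞ μ) : MemLp f 2 μ := by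
  rw [memLp_two_iff_integrable_sq h1.1]
  have h : MemLp (f * f) 1 μ := h1.mul h2
  refine (memLp_one_iff_integrable.1 h).congr (ae_of_all _ fun x => ?_)
  simp [pow_two]

/-- The frozen equation tested with a product `θ(t)ψ(x)`. -/
theorem IsFrozenSolution.integral_product_test {β b : ℝ → ℝ} {D K : Sp d → Sp d}
    {u v : ℝ → Sp d → ℝ} (h : IsFrozenSolution β b D K T u v) {θ : ℝ → ℝ} {ψ : Sp d → ℝ}
    (hθ : IsTest (Ioo 0 T) θ) (hψ : IsTest univ ψ) :
    ∫ z, (v z.1 z.2 * (deriv θ z.1 * ψ z.2) + θ z.1 *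
      (diffusivity β (u z.1 z.2) * v z.1 z.2 * Δ ψ z.2
        + inner ℝ (v z.1 z.2 • drift b D K (u z.1) z.2) (gradient ψ z.2)))
      ∂(cylMeasure d T) = 0 := by
  rw [← h.2.2.2 _ (isTest_mul hθ hψ)]
  refine integral_congr_ae (ae_of_all _ fun z => ?_)
  have hd : deriv (fun s => θ s * ψ z.2) z.1 = deriv θ z.1 * ψ z.2 :=
    deriv_mul_const (hθ.1.differentiable (by simp) z.1) _
  dsimp only
  rw [hd, laplacian_const_mul hψ.1, gradient_const_mul hψ.1, inner_smul_right]
  ring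

theorem integrable_product_test {f g : ℝ × Sp d → ℝ} {F : ℝ × Sp d → Sp d}
    (hf : Integrable f (cylMeasure d T)) (hg : Integrable g (cylMeasure d T))
    (hF : Integrable F (cylMeasure d T)) {θ : ℝ → ℝ} {ψ : Sp d → ℝ}
    (hθ : IsTest (Ioo 0 T) θ) (hψ : IsTest univ ψ) :
    Integrable (fun z => f z * (deriv θ z.1 * ψ z.2) + θ z.1 *
      (g z * Δ ψ z.2 + inner ℝ (F z) (gradient ψ z.2))) (cylMeasure d T) := by
  obtain ⟨C, hC⟩ := hψ.smoothBounded
  refine ((integrable_mul_time (integrable_mul_bounded hf hC) (hθ.1.continuous_deriv (by simp))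
    hθ.2.1.deriv).add (integrable_mul_time (integrable_spatial_integrand hg hF hC)
    hθ.1.continuous hθ.2.1)).congr (ae_of_all _ fun z => ?_)
  simp only [Pi.add_apply]
  ring

/-- The restriction `δ ≤ T` allows `v₁ - v₂` to be replaced by a representative that agrees with it
only on the cylinder. -/
theorem SameWeakInitialDatum.exists_bound {v₁ v₂ : ℝ → Sp d → ℝ}
    (h : SameWeakInitialDatum v₁ v₂) (hT : 0 < T) {ψ : Sp d → ℝ} (hψ : IsTest univ ψ) {ε : ℝ}
    (hε : 0 < ε) : ∃ δ > 0, δ ≤ T ∧ ∀ᵐ s ∂(volume.restrict (Ioo 0 δ)),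
      |∫ x, (v₁ s x - v₂ s x) * ψ x| ≤ ε := by
  have h1 := (h ψ hψ).eventually_lt_const (u := ENNReal.ofReal ε) (by simpa using hε)
  obtain ⟨δ, hδ, hδT⟩ := (h1.and (Ioc_mem_nhdsGT hT)).exists
  refine ⟨δ, hδT.1, hδT.2, ?_⟩
  filter_upwards [ENNReal.ae_le_essSup (μ := volume.restrict (Ioo 0 δ))
    fun s => ‖∫ x, (v₁ s x - v₂ s x) * ψ x‖ₑ] with s hs
  have := hs.trans hδ.le
  rwa [Real.enorm_eq_ofReal_abs, ENNReal.ofReal_le_ofReal_iff hε.le] at this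

end FrozenFP

/-! ### Reduction to the uniqueness theorem for the difference -/

theorem theorem4p3 (d : ℕ) (hd : 2 ≤ d) (β b : ℝ → ℝ)
    (D K : FrozenFP.Sp d → FrozenFP.Sp d) (hyp : FrozenFP.Hypotheses d β b D K)
    (u₀ : FrozenFP.Sp d → ℝ) (hu₀ : FrozenFP.IsProbDensity u₀) (hu₀' : MemLp u₀ ∞ volume)
    (u : ℝ → FrozenFP.Sp d → ℝ) (hu : FrozenFP.IsWeakSolution β b D K u₀ u)
    (hu' : FrozenFP.InSolutionClass u)
    (T : ℝ) (hT : 0 < T) (v₁ v₂ : ℝ → FrozenFP.Sp d → ℝ)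
    (hv₁ : FrozenFP.MemL1Linf T v₁) (hv₂ : FrozenFP.MemL1Linf T v₂)
    (hsol₁ : FrozenFP.IsFrozenSolution β b D K T u v₁)
    (hsol₂ : FrozenFP.IsFrozenSolution β b D K T u v₂)
    (hinit : FrozenFP.SameWeakInitialDatum v₁ v₂) :
    ∀ᵐ z ∂(FrozenFP.cylMeasure d T), v₁ z.1 z.2 = v₂ z.1 z.2 := by
  open FrozenFP in
  obtain ⟨M, -, hM⟩ := (hu'.2.2 T hT).exists_ae_norm_le
  obtain ⟨C₁, hC₁⟩ := exists_diffusivity_le hyp.β_contDiff hyp.β_zero M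
  obtain ⟨C₂, hC₂⟩ := exists_ae_norm_drift_le hyp hu'.1 hM
  obtain ⟨α, hα, hαβ⟩ := hyp.β_deriv
  set a : ℝ × Sp d → ℝ := fun z => diffusivity β (u z.1 z.2) with ha
  set e : ℝ × Sp d → Sp d := fun z => drift b D K (u z.1) z.2 with he
  have haα : ∀ z, α ≤ a z := fun z => by
    obtain ⟨c, -, hc⟩ := exists_diffusivity_eq_deriv hyp.β_contDiff hyp.β_zero (u z.1 z.2)
    rw [ha]; dsimp only; rw [hc]; exact hαβ c
  have haC : ∀ᵐ z ∂(cylMeasure d T), ‖a z‖ ≤ C₁ := by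
    filter_upwards [hM] with z hz using hC₁ _ hz
  -- Measurability of the product comes from the local integrability in the definition of a
  -- solution; none is required of `a` itself.
  have hAi : ∀ {v : ℝ → Sp d → ℝ}, MemL1Linf T v → IsFrozenSolution β b D K T u v →
      Integrable (fun z => a z * v z.1 z.2) (cylMeasure d T) := fun {v} hv hs => by
    refine ((memLp_one_iff_integrable.1 hv.1).norm.const_mul C₁).mono'
      hs.2.1.aestronglyMeasurable ?_
    filter_upwards [haC] with z hz
    rw [norm_mul]
    exact mul_le_mul_of_nonneg_right hz (norm_nonneg _)
  have hBi : ∀ {v : ℝ → Sp d → ℝ}, MemL1Linf T v → IsFrozenSolution β b D K T u v →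
      Integrable (fun z => v z.1 z.2 • e z) (cylMeasure d T) := fun {v} hv hs => by
    refine ((memLp_one_iff_integrable.1 hv.1).norm.mul_const C₂).mono'
      hs.2.2.1.aestronglyMeasurable ?_
    filter_upwards [hC₂] with z hz
    rw [norm_smul]
    exact mul_le_mul_of_nonneg_left hz (norm_nonneg _)
  have hvi₁ := memLp_one_iff_integrable.1 hv₁.1
  have hvi₂ := memLp_one_iff_integrable.1 hv₂.1
  set v : ℝ × Sp d → ℝ := fun z => v₁ z.1 z.2 - v₂ z.1 z.2 with hv
  have hvi : Integrable v (cylMeasure d T) := hvi₁.sub hvi₂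
  have hv2 : MemLp v 2 (cylMeasure d T) :=
    (hv₁.1.memLp_two_of_one_of_top hv₁.2).sub (hv₂.1.memLp_two_of_one_of_top hv₂.2)
  have hav : Integrable (fun z => a z * v z) (cylMeasure d T) :=
    ((hAi hv₁ hsol₁).sub (hAi hv₂ hsol₂)).congr (ae_of_all _ fun z => by
      simp only [Pi.sub_apply, hv]; ring)
  have hve : Integrable (fun z => v z • e z) (cylMeasure d T) :=
    ((hBi hv₁ hsol₁).sub (hBi hv₂ hsol₂)).congr (ae_of_all _ fun z => by
      simp only [Pi.sub_apply, hv, sub_smul])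
  -- representatives for which all the bounds hold everywhere
  obtain ⟨V₀, hV₀, hV₀e⟩ := hvi.aestronglyMeasurable
  obtain ⟨A₀, hA₀, hA₀e⟩ := hav.aestronglyMeasurable
  obtain ⟨B₀, hB₀, hB₀e⟩ := hve.aestronglyMeasurable
  set C : ℝ := max C₁ C₂ with hC
  -- `S` has full measure in the cylinder. Off `S` the three representatives are replaced by zero,
  -- where the inequalities hold trivially.
  set S : Set (ℝ × Sp d) := {z | ‖A₀ z‖ ≤ C * ‖V₀ z‖} ∩ {z | ‖B₀ z‖ ≤ C * ‖V₀ z‖} ∩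
    {z | α * V₀ z ^ 2 ≤ V₀ z * A₀ z} with hS
  have hSm : MeasurableSet S :=
    ((hA₀.norm.measurableSet_le (hV₀.norm.const_mul C)).inter
      (hB₀.norm.measurableSet_le (hV₀.norm.const_mul C))).inter
      (((hV₀.pow 2).const_mul α).measurableSet_le (hV₀.mul hA₀))
  have hSae : ∀ᵐ z ∂(cylMeasure d T), z ∈ S := by
    filter_upwards [hV₀e, hA₀e, hB₀e, haC, hC₂] with z h1 h2 h3 h4 h5
    refine ⟨⟨?_, ?_⟩, ?_⟩
    · rw [mem_ofPred_eq, ← h1, ← h2, norm_mul]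
      exact mul_le_mul_of_nonneg_right (h4.trans (le_max_left _ _)) (norm_nonneg _)
    · rw [mem_ofPred_eq, ← h1, ← h3, norm_smul, mul_comm]
      exact mul_le_mul_of_nonneg_right (h5.trans (le_max_right _ _)) (norm_nonneg _)
    · rw [mem_ofPred_eq, ← h1, ← h2]
      nlinarith [mul_le_mul_of_nonneg_right (haα z) (sq_nonneg (v z))]
  have hVe : v =ᵐ[cylMeasure d T] S.indicator V₀ := by
    filter_upwards [hSae, hV₀e] with z h1 h2
    rw [indicator_of_mem h1, h2]
  have hAe : (fun z => a z * v z) =ᵐ[cylMeasure d T] S.indicator A₀ := by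
    filter_upwards [hSae, hA₀e] with z h1 h2
    rw [indicator_of_mem h1, h2]
  have hBe : (fun z => v z • e z) =ᵐ[cylMeasure d T] S.indicator B₀ := by
    filter_upwards [hSae, hB₀e] with z h1 h2
    rw [indicator_of_mem h1, h2]
  have hweak : IsWeakNullSolution T (S.indicator V₀) (S.indicator A₀) (S.indicator B₀) := by
    refine ⟨hvi.congr hVe, hav.congr hAe, hve.congr hBe, fun θ ψ hθ hψ => ?_,
      fun ψ hψ ε hε => ?_⟩
    · have h1 := hsol₁.integral_product_test hθ hψ
      have h2 := hsol₂.integral_product_test hθ hψ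
      have i1 := integrable_product_test hvi₁ (hAi hv₁ hsol₁) (hBi hv₁ hsol₁) hθ hψ
      have i2 := integrable_product_test hvi₂ (hAi hv₂ hsol₂) (hBi hv₂ hsol₂) hθ hψ
      have h3 := integral_sub i1 i2
      rw [h1, h2, sub_zero] at h3
      rw [← h3]
      refine integral_congr_ae ?_
      filter_upwards [hVe, hAe, hBe] with z e1 e2 e3
      rw [← e1, ← e2, ← e3]
      simp only [hv, ha, he, inner_smul_left, conj_trivial]
      ring
    · obtain ⟨δ, hδ, hδT, h⟩ := hinit.exists_bound hT hψ hε
      refine ⟨δ, hδ, ?_⟩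
      have hVs := hVe
      rw [cylMeasure_eq_prod] at hVs
      filter_upwards [h, ae_restrict_of_ae_restrict_of_subset (Ioo_subset_Ioo_right hδT)
        (Measure.ae_ae_of_ae_prod hVs)] with s hs hs'
      refine le_of_eq_of_le (congrArg _ (integral_congr_ae ?_)) hs
      filter_upwards [hs'] with x hx
      rw [← hx]
  have hzero := hweak.ae_eq_zero (C := C) hT (hV₀.indicator hSm) (hA₀.indicator hSm)
    (hB₀.indicator hSm) ((memLp_congr_ae hVe).1 hv2) hα ?_ ?_ ?_
  · filter_upwards [hzero, hVe] with z h1 h2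
    rw [h1] at h2
    exact sub_eq_zero.1 h2
  all_goals
    intro z
    by_cases hz : z ∈ S
    · simp only [indicator_of_mem hz]
      first | exact hz.1.1 | exact hz.1.2 | exact hz.2
    · simp [indicator_of_notMem hz]
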